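/- **Definitions.** Let $H_2(p)=-p\log_2 p-(1-p)\log_2(1-p)$ be the binary entropy function, let $H_2^{-1}:[0,1]\to[0,1/2]$ be the inverse of its restriction to $[0,1/2]$, and let $$\kappa_Z(\delta)=\sup_{0<\kappa<1-H_2(\delta)}\kappa\left(1-\frac{\delta}{H_2^{-1}(1-\kappa)}\right)$$ be the rate given by the Zyablov bound (the supremum of the empty set, which occurs for $\delta=1/2$, is $0$). A binary $(m,K,d)$-code is a set $C\subseteq\{0,1\}^m$ of $K$ words with pairwise Hamming distances at least $d$; it meets the Gilbert–Varshamov bound if $\frac1m\log_2K\ge 1-H_2(d/m)$. A unique decoder for $C$ maps every word at distance at most $\lfloor (d-1)/2\rfloor$ from a codeword to that codeword (and every other word to an arbitrary word). Algorithms are programs of a random access machine with logarithmic cost that can draw independent fair random bits; a call of a black box on a word of length $m$ costs $m+1$. **Theorem.** Let $m\ge1$, let $x_0,\dots,x_{n-1}\in\{0,1\}^m$ be $n$ binary vectors such that exactly one pair of indices $\{i,j\}$, $i\ne j$ (not known to the algorithm), achieves the minimum pairwise Hamming distance $d_{\min}$; the second smallest distance may be as small as $d_{\min}+1$. Suppose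 that the value of $d_{\min}$ is given, and let $\delta:=d_{\min}/m$. 1. There is a randomized algorithm that, for every such input, runs in time $O\big(n\log^2 n\cdot 2^{(1-\kappa_Z(\delta)-\delta)m}\cdot\mathrm{poly}(m)\big)$ for every outcome of its random bits, and finds the closest pair $\{i,j\}$ with probability at least $1-1/n^2$. 2. There is a randomized algorithm that, for every such input, and given as a black box a unique decoder for some binary $(m,K,d_{\min}+1)$-code that meets the Gilbert–Varshamov bound, runs in time $O\big(n\log^2 n\cdot 2^{(H_2(\delta)-\delta)m}\cdot\mathrm{poly}(m)\big)$ for every outcome of its random bits, and finds the closest pair $\{i,j\}$ with probability at least $1-1/n^2$. In each part the algorithm, the constant and the polynomial do not depend on the input, i.e. not on $n$, $m$, $d_{\min}$, the vectors, the code or the decoder. -/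

import Mathlib

/-! ### Entropy, the Zyablov rate, and binary codes -/

/-- Binary words of length `m`, i.e. the elements of `{0,1}^m`. -/
abbrev BinWord (m : ℕ) : Type := Fin m → Bool

/-- The binary entropy function in bits: `H₂(p) = -p log₂ p - (1 - p) log₂ (1 - p)`. -/
noncomputable def entropy2 (p : ℝ) : ℝ := Real.binEntropy p / Real.log 2

/-- The inverse `H₂⁻¹ : [0,1] → [0,1/2]` of the restriction of `H₂` to `[0,1/2]`. -/
noncomputable def entropy2Inv (y : ℝ) : ℝ :=
  Function.invFunOn entropy2 (Set.Icc (0 : ℝ) (1 / 2)) y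

/-- The rate given by the Zyablov bound at relative distance `δ`:
the supremum of `κ (1 - δ / H₂⁻¹(1 - κ))` over the inner rates `0 < κ < 1 - H₂(δ)`.
It is `1` at `δ = 0`, and `0` for `1/2 ≤ δ ≤ 1`. -/
noncomputable def zyablovRate (δ : ℝ) : ℝ :=
  sSup ((fun κ : ℝ => κ * (1 - δ / entropy2Inv (1 - κ))) '' Set.Ioo 0 (1 - entropy2 δ))

/-- Any two distinct codewords of `C` are at Hamming distance at least `d`:
`C` is an `(m, |C|, d)`-code. -/
def HasMinDist {m : ℕ} (C : Finset (BinWord m)) (d : ℕ) : Prop :=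
  ∀ c ∈ C, ∀ c' ∈ C, c ≠ c' → d ≤ hammingDist c c'

/-- The `(m, |C|, d)`-code `C` meets the Gilbert-Varshamov bound: its rate `log₂ |C| / m` is at
least `1 - H₂(d/m)`. -/
def MeetsGV {m : ℕ} (C : Finset (BinWord m)) (d : ℕ) : Prop :=
  (2 : ℝ) ^ ((1 - entropy2 ((d : ℝ) / m)) * m) ≤ (C.card : ℝ)

/-- `D` is a unique decoder for the `(m, |C|, d)`-code `C`: a word within the decoding radius
`⌊(d - 1) / 2⌋` of a codeword is mapped to that codeword. Nothing is required of other words. -/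
def IsUniqueDecoder {m : ℕ} (C : Finset (BinWord m)) (d : ℕ) (D : BinWord m → BinWord m) : Prop :=
  ∀ x : BinWord m, ∀ c ∈ C, hammingDist x c ≤ (d - 1) / 2 → D x = c

/-- `{x i, x j}` is the unique closest pair among the words `x 0, …, x (n - 1)`, and `d` is its
distance. -/
def IsUniqueClosestPair {n m : ℕ} (x : Fin n → BinWord m) (i j : Fin n) (d : ℕ) : Prop :=
  i ≠ j ∧ hammingDist (x i) (x j) = d ∧
    ∀ a b : Fin n, a ≠ b → s(a, b) ≠ s(i, j) → d < hammingDist (x a) (x b)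

/-! ### Randomized random access machines with logarithmic cost

A program works on registers and on arrays, all holding natural numbers. Registers and arrays are
named by fixed numbers that occur in the program; array indices are computed. Every evaluation of
a subexpression costs one plus the bit length of its value. -/

namespace RAM

/-- The memory, and the part of the random tape that has not been read yet. -/
structure State where
  reg : ℕ → ℕ
  arr : ℕ → ℕ → ℕ
  tape : ℕ → Bool

/-- Expressions. -/
inductive Exp where
  | lit (k : ℕ)
  | var (r : ℕ)
  | get (a : ℕ) (e : Exp)
  | add (e₁ e₂ : Exp)
  | sub (e₁ e₂ : Exp)
  | mul (e₁ e₂ : Exp)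
  | div (e₁ e₂ : Exp)
  | lt (e₁ e₂ : Exp)
  | eq (e₁ e₂ : Exp)

/-- The value of an expression; subtraction is truncated, division is rounded down, and the
comparisons return `0` or `1`. -/
def Exp.eval (s : State) : Exp → ℕ
  | .lit k => k
  | .var r => s.reg r
  | .get a e => s.arr a (e.eval s)
  | .add e₁ e₂ => e₁.eval s + e₂.eval s
  | .sub e₁ e₂ => e₁.eval s - e₂.eval s
  | .mul e₁ e₂ => e₁.eval s * e₂.eval s
  | .div e₁ e₂ => e₁.eval s / e₂.eval s
  | .lt e₁ e₂ => if e₁.eval s < e₂.eval s then 1 else 0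
  | .eq e₁ e₂ => if e₁.eval s = e₂.eval s then 1 else 0

/-- The logarithmic cost of evaluating an expression: every node costs one plus the bit length of
its value. -/
def Exp.cost (s : State) : Exp → ℕ
  | .lit k => 1 + Nat.size k
  | .var r => 1 + Nat.size (s.reg r)
  | .get a e => 1 + Nat.size ((Exp.get a e).eval s) + e.cost s
  | .add e₁ e₂ => 1 + Nat.size ((Exp.add e₁ e₂).eval s) + e₁.cost s + e₂.cost s
  | .sub e₁ e₂ => 1 + Nat.size ((Exp.sub e₁ e₂).eval s) + e₁.cost s + e₂.cost s
  | .mul e₁ e₂ => 1 + Nat.size ((Exp.mul e₁ e₂).eval s) + e₁.cost s + e₂.cost s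
  | .div e₁ e₂ => 1 + Nat.size ((Exp.div e₁ e₂).eval s) + e₁.cost s + e₂.cost s
  | .lt e₁ e₂ => 1 + Nat.size ((Exp.lt e₁ e₂).eval s) + e₁.cost s + e₂.cost s
  | .eq e₁ e₂ => 1 + Nat.size ((Exp.eq e₁ e₂).eval s) + e₁.cost s + e₂.cost s

/-- Programs. `store a e₁ e₂` writes the value of `e₂` into cell `e₁` of array `a`, `flip r` puts a
fresh random bit into register `r`, and `decode a b` hands the first `m` cells of array `a` to the
black-box decoder and puts its answer into the first `m` cells of array `b`. Guards of `ite` and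
`loop` (a while loop) count as true if their value is not `0`. -/
inductive Prog where
  | skip
  | assign (r : ℕ) (e : Exp)
  | store (a : ℕ) (e₁ e₂ : Exp)
  | flip (r : ℕ)
  | decode (a b : ℕ)
  | seq (p q : Prog)
  | ite (e : Exp) (p q : Prog)
  | loop (e : Exp) (p : Prog)

/-- The state after `r := v`. -/
def State.setReg (s : State) (r v : ℕ) : State :=
  { s with reg := Function.update s.reg r v }

/-- The state after cell `k` of array `a` has been set to `v`. -/
def State.setArr (s : State) (a k v : ℕ) : State :=
  { s with arr := Function.update s.arr a (Function.update (s.arr a) k v) }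

/-- The state after the next bit of the random tape has been moved to register `r`. -/
def State.flipInto (s : State) (r : ℕ) : State :=
  { s with
    reg := Function.update s.reg r (s.tape 0).toNat
    tape := fun k => s.tape (k + 1) }

/-- The word of length `m` in the first `m` cells of array `a` (nonzero cells are read as `1`). -/
def State.readWord (s : State) (m a : ℕ) : BinWord m := fun k => decide (s.arr a k ≠ 0)

/-- The state after the word `w` has been written to the first `m` cells of array `b`. -/
def State.writeWord {m : ℕ} (s : State) (b : ℕ) (w : BinWord m) : State :=
  { s with
    arr := Function.update s.arr b
      (fun k => if h : k < m then (w ⟨k, h⟩).toNat else s.arr b k) }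

/-- `Exec dec p s t s'`: started in state `s`, the program `p` halts after time `t` in state `s'`.
Here `dec` is the black-box decoder, if there is one; without it, a program that executes `decode`
is stuck and never halts. A call of the black box costs `m + 1`. -/
inductive Exec {m : ℕ} (dec : Option (BinWord m → BinWord m)) :
    Prog → State → ℕ → State → Prop where
  | skip (s : State) : Exec dec .skip s 1 s
  | assign (r : ℕ) (e : Exp) (s : State) :
      Exec dec (.assign r e) s (1 + e.cost s) (s.setReg r (e.eval s))
  | store (a : ℕ) (e₁ e₂ : Exp) (s : State) :
      Exec dec (.store a e₁ e₂) s (1 + e₁.cost s + e₂.cost s)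
        (s.setArr a (e₁.eval s) (e₂.eval s))
  | flip (r : ℕ) (s : State) : Exec dec (.flip r) s 1 (s.flipInto r)
  | decode (a b : ℕ) (s : State) (D : BinWord m → BinWord m) (hD : dec = some D) :
      Exec dec (.decode a b) s (m + 1) (s.writeWord b (D (s.readWord m a)))
  | seq {p q : Prog} {s s' s'' : State} {t t' : ℕ} (hp : Exec dec p s t s')
      (hq : Exec dec q s' t' s'') : Exec dec (.seq p q) s (t + t') s''
  | iteTrue {e : Exp} {p q : Prog} {s s' : State} {t : ℕ} (he : e.eval s ≠ 0)
      (hp : Exec dec p s t s') : Exec dec (.ite e p q) s (1 + e.cost s + t) s'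
  | iteFalse {e : Exp} {p q : Prog} {s s' : State} {t : ℕ} (he : e.eval s = 0)
      (hq : Exec dec q s t s') : Exec dec (.ite e p q) s (1 + e.cost s + t) s'
  | loopDone {e : Exp} {p : Prog} {s : State} (he : e.eval s = 0) :
      Exec dec (.loop e p) s (1 + e.cost s) s
  | loopStep {e : Exp} {p : Prog} {s s' s'' : State} {t t' : ℕ} (he : e.eval s ≠ 0)
      (hp : Exec dec p s t s') (hl : Exec dec (.loop e p) s' t' s'') :
      Exec dec (.loop e p) s (1 + e.cost s + t + t') s''

/-- Execution is deterministic, once the random tape is fixed. -/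
theorem Exec.deterministic {m : ℕ} {dec : Option (BinWord m → BinWord m)} {p : Prog}
    {s s₁ s₂ : State} {t₁ t₂ : ℕ} (h₁ : Exec dec p s t₁ s₁) (h₂ : Exec dec p s t₂ s₂) :
    t₁ = t₂ ∧ s₁ = s₂ := by
  induction h₁ generalizing t₂ s₂ with
  | skip s => cases h₂; exact ⟨rfl, rfl⟩
  | assign r e s => cases h₂; exact ⟨rfl, rfl⟩
  | store a e₁ e₂ s => cases h₂; exact ⟨rfl, rfl⟩
  | flip r s => cases h₂; exact ⟨rfl, rfl⟩
  | decode a b s D hD =>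
    cases h₂ with
    | decode _ _ _ D' hD' =>
      rw [hD] at hD'
      cases hD'
      exact ⟨rfl, rfl⟩
  | seq hp hq ihp ihq =>
    cases h₂ with
    | seq hp' hq' =>
      obtain ⟨rfl, rfl⟩ := ihp hp'
      obtain ⟨rfl, rfl⟩ := ihq hq'
      exact ⟨rfl, rfl⟩
  | iteTrue he hp ih =>
    cases h₂ with
    | iteTrue he' hp' =>
      obtain ⟨rfl, rfl⟩ := ih hp'
      exact ⟨rfl, rfl⟩
    | iteFalse he' hq' => exact absurd he' he
  | iteFalse he hq ih =>
    cases h₂ with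
    | iteTrue he' hp' => exact absurd he he'
    | iteFalse he' hq' =>
      obtain ⟨rfl, rfl⟩ := ih hq'
      exact ⟨rfl, rfl⟩
  | loopDone he =>
    cases h₂ with
    | loopDone he' => exact ⟨rfl, rfl⟩
    | loopStep he' hp' hl' => exact absurd he he'
  | loopStep he hp hl ihp ihl =>
    cases h₂ with
    | loopDone he' => exact absurd he' he
    | loopStep he' hp' hl' =>
      obtain ⟨rfl, rfl⟩ := ihp hp'
      obtain ⟨rfl, rfl⟩ := ihl hl'
      exact ⟨rfl, rfl⟩

/-- The initial state: `n`, `m` and `d` are in registers `0`, `1` and `2`, bit `k` of the word `x i`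
is in cell `i * m + k` of array `0`, everything else is `0`, and the random tape is `ω`. -/
def initState {n m : ℕ} (x : Fin n → BinWord m) (d : ℕ) (ω : ℕ → Bool) : State where
  reg r := if r = 0 then n else if r = 1 then m else if r = 2 then d else 0
  arr a c := if a = 0 then
      if h : c < n * m then
        (x (finProdFinEquiv.symm ⟨c, h⟩).1 (finProdFinEquiv.symm ⟨c, h⟩).2).toNat
      else 0
    else 0
  tape := ω

/-- The law of an infinite sequence of independent fair random bits. -/
noncomputable def fairBits : MeasureTheory.Measure (ℕ → Bool) :=
  MeasureTheory.Measure.infinitePi fun _ : ℕ => (PMF.uniformOfFintype Bool).toMeasure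

/-- On the words `x` and the number `d`, the program `p` halts within time `T` for every outcome of
its random bits, and with probability at least `1 - 1 / n ^ 2` it leaves the indices `i` and `j`, in
some order, in registers `0` and `1`. -/
def FindsPair {n m : ℕ} (p : Prog) (dec : Option (BinWord m → BinWord m)) (x : Fin n → BinWord m)
    (d : ℕ) (i j : Fin n) (T : ℝ) : Prop :=
  (∀ ω : ℕ → Bool, ∃ (t : ℕ) (f : State), Exec dec p (initState x d ω) t f ∧ (t : ℝ) ≤ T) ∧
    1 - 1 / (n : ℝ) ^ 2 ≤ fairBits.real {ω : ℕ → Bool | ∃ (t : ℕ) (f : State),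
      Exec dec p (initState x d ω) t f ∧ s(f.reg 0, f.reg 1) = s((i : ℕ), (j : ℕ))}

end RAM

namespace RAM

/-! ### A cost logic for programs -/

/-! One program, without decoder calls, serves both parts. Let P = 2^(m+2), δ = d/m, and let a be δP
rounded up and capped at P/2. Each round draws a random partial word: a coordinate is fixed to 0 or
to 1 with probability a/P each and is free otherwise. Points are hashed by their bits on the free
coordinates, and a bucket keeps only a point that differs from the partial word in at most d/2 fixed
coordinates. Two such points in one bucket are within distance d of each other, so by uniqueness no
third point can displace the first member of the closest pair before the second one arrives. Hence
one stored point per bucket and one distance computation per point suffice, and a round takes n ·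
poly(m) steps (`wp_points`).

A round succeeds if all d differing coordinates are fixed, exactly ⌊d/2⌋ of them against the first
point, and no agreeing coordinate is fixed to the wrong value. For each choice of the ⌊d/2⌋
coordinates this has probability (a/P)^d (1 - a/P)^(m-d); the choices give disjoint events, and
there are at least 2^d/(d+1) of them (`card_goodBlocks`). Up to polynomial factors the success
probability is thus at least 2^(-(H₂(δ)-δ)m) if 2d ≤ m, and 2^(-(1-δ)m) if 2d > m, where a = P/2
(`pow_le_denom`). At most one pair of points coincides, so n ≤ 2^(m+1), and poly(m) times the
reciprocal many rounds push the failure probability below exp(-2(m+1)) ≤ 1/n² (`failure_le`).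

It remains to compare exponents. Always κ_Z(δ) ≤ 1 - H₂(δ), and κ_Z(δ) ≤ 0 for δ ≥ 1/2, which gives
part one. For part two only 2d > m needs an argument: by the Plotkin bound the code has at most
2(d+1) words, so meeting the Gilbert–Varshamov bound forces 2^((1-H₂(δ))m) ≤ 2(m+1), and 2^((1-δ)m)
exceeds the target by at most that factor (`expFactor_le_entropy`).

Running times come from a Hoare-style calculus (`Wp`) that counts elementary steps while all numbers
stay below 2^`width m`; this turns steps into logarithmic cost at the price of a polynomial in m. -/

/-- A bound for the number of nodes of an expression and for the literals in it. -/
def Exp.weight : Exp → ℕ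
  | .lit k => k + 1
  | .var _ => 1
  | .get _ e => e.weight + 1
  | .add e₁ e₂ => e₁.weight + e₂.weight + 1
  | .sub e₁ e₂ => e₁.weight + e₂.weight + 1
  | .mul e₁ e₂ => e₁.weight + e₂.weight + 1
  | .div e₁ e₂ => e₁.weight + e₂.weight + 1
  | .lt e₁ e₂ => e₁.weight + e₂.weight + 1
  | .eq e₁ e₂ => e₁.weight + e₂.weight + 1

/-- All registers and cells hold numbers of at most `W` bits. -/
def Bounded (W : ℕ) (s : State) : Prop :=
  (∀ r, s.reg r < 2 ^ W) ∧ ∀ a k, s.arr a k < 2 ^ W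

/-- Every binary operation is bounded by the sum or the product of its arguments, and the extra
factor 2^W ≥ 2 earned at each node pays for the sum. A literal k has weight k + 1 because k < 2^k.
-/
theorem Exp.eval_lt {W : ℕ} (hW : 1 ≤ W) {s : State} (hs : Bounded W s) (e : Exp) :
    e.eval s < 2 ^ (W * e.weight) := by
  have key : ∀ {w₁ w₂ v₁ v₂ v : ℕ}, v₁ < 2 ^ (W * w₁) → v₂ < 2 ^ (W * w₂) →
      v ≤ v₁ + v₂ ∨ v ≤ v₁ * v₂ → v < 2 ^ (W * (w₁ + w₂ + 1)) := by
    intro w₁ w₂ v₁ v₂ v h₁ h₂ h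
    have h2 : 2 ≤ 2 ^ W := by
      calc 2 = 2 ^ 1 := rfl
        _ ≤ 2 ^ W := Nat.pow_le_pow_right (by norm_num) hW
    have e : 2 ^ (W * (w₁ + w₂ + 1)) = 2 ^ (W * w₁) * 2 ^ (W * w₂) * 2 ^ W := by
      rw [← pow_add, ← pow_add]; congr 1; ring
    rw [e]
    generalize 2 ^ (W * w₁) = A at *
    generalize 2 ^ (W * w₂) = B at *
    generalize 2 ^ W = T at *
    have hA : 1 ≤ A := by omega
    have hB : 1 ≤ B := by omega
    have hAB : A * B * 2 ≤ A * B * T := Nat.mul_le_mul_left _ h2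
    rcases h with h | h
    · have : A + B ≤ A * B * 2 := by nlinarith
      omega
    · have : v₁ * v₂ < A * B := Nat.mul_lt_mul'' h₁ h₂
      omega
  have h01 : ∀ {w₁ w₂ : ℕ} {p : Prop} [Decidable p],
      (if p then 1 else 0) < 2 ^ (W * (w₁ + w₂ + 1)) := by
    intro w₁ w₂ p _
    have : 1 < 2 ^ (W * (w₁ + w₂ + 1)) := Nat.one_lt_two_pow (by positivity)
    split_ifs <;> omega
  induction e with
  | lit k =>
    calc k < 2 ^ k := Nat.lt_two_pow_self
      _ ≤ 2 ^ (W * (k + 1)) := Nat.pow_le_pow_right (by norm_num) (by nlinarith)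
  | var r => simpa [Exp.weight, Exp.eval] using hs.1 r
  | get a e ih =>
    calc (Exp.get a e).eval s < 2 ^ W := hs.2 _ _
      _ ≤ _ := Nat.pow_le_pow_right (by norm_num) (by simp only [Exp.weight]; nlinarith)
  | add e₁ e₂ h₁ h₂ => exact key h₁ h₂ (.inl le_rfl)
  | sub e₁ e₂ h₁ h₂ => exact key h₁ h₂ (.inl (by simp only [Exp.eval]; omega))
  | mul e₁ e₂ h₁ h₂ => exact key h₁ h₂ (.inr le_rfl)
  | div e₁ e₂ h₁ h₂ => exact key h₁ h₂ (.inl ((Nat.div_le_self _ _).trans (Nat.le_add_right _ _)))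
  | lt e₁ e₂ h₁ h₂ => exact h01
  | eq e₁ e₂ h₁ h₂ => exact h01

theorem Exp.cost_le {W : ℕ} (hW : 1 ≤ W) {s : State} (hs : Bounded W s) (e : Exp) :
    e.cost s ≤ e.weight * (1 + W * e.weight) := by
  have sz : ∀ e : Exp, Nat.size (e.eval s) ≤ W * e.weight :=
    fun e => Nat.size_le.2 (e.eval_lt hW hs)
  have key : ∀ {w₁ w₂ c₁ c₂ v : ℕ}, c₁ ≤ w₁ * (1 + W * w₁) → c₂ ≤ w₂ * (1 + W * w₂) →
      v ≤ W * (w₁ + w₂ + 1) →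
      1 + v + c₁ + c₂ ≤ (w₁ + w₂ + 1) * (1 + W * (w₁ + w₂ + 1)) := by
    intro w₁ w₂ c₁ c₂ v h₁ h₂ hv
    have : 0 ≤ W * w₁ * w₂ := Nat.zero_le _
    nlinarith [Nat.zero_le (W * w₁), Nat.zero_le (W * w₂)]
  induction e with
  | lit k =>
    have := sz (.lit k)
    simp only [Exp.weight, Exp.eval, Exp.cost] at *
    nlinarith [Nat.zero_le (k * (1 + W * (k + 1)))]
  | var r =>
    have := sz (.var r)
    simp only [Exp.weight, Exp.eval, Exp.cost] at *
    omega
  | get a e ih =>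
    have := key ih (c₂ := 0) (w₂ := 0) (by simp) (sz (.get a e))
    simpa [Exp.weight, Exp.cost] using this
  | add e₁ e₂ h₁ h₂ => exact key h₁ h₂ (sz (.add e₁ e₂))
  | sub e₁ e₂ h₁ h₂ => exact key h₁ h₂ (sz (.sub e₁ e₂))
  | mul e₁ e₂ h₁ h₂ => exact key h₁ h₂ (sz (.mul e₁ e₂))
  | div e₁ e₂ h₁ h₂ => exact key h₁ h₂ (sz (.div e₁ e₂))
  | lt e₁ e₂ h₁ h₂ => exact key h₁ h₂ (sz (.lt e₁ e₂))
  | eq e₁ e₂ h₁ h₂ => exact key h₁ h₂ (sz (.eq e₁ e₂))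

/-- A bound for the cost of an elementary step on numbers of at most `W` bits that evaluates
expressions of weight at most `20`. -/
def unitCost (W : ℕ) : ℕ := 1000 * (W + 1)

/-- The factor two lets one unit cover an instruction that evaluates two expressions, such as
`store`. -/
theorem Exp.cost_le_unit {W : ℕ} (hW : 1 ≤ W) {s : State} (hs : Bounded W s) {e : Exp}
    (he : e.weight ≤ 20) : 2 * e.cost s + 1 ≤ unitCost W := by
  have h1 := e.cost_le hW hs
  have h2 : e.weight * (1 + W * e.weight) ≤ 20 * (1 + W * 20) := by gcongr
  unfold unitCost
  omega

/-! ### State updates and the syntactic frame condition. -/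

@[simp] theorem State.setReg_reg (s : State) (r v r' : ℕ) :
    (s.setReg r v).reg r' = if r' = r then v else s.reg r' := Function.update_apply _ _ _ _

@[simp] theorem State.setReg_arr (s : State) (r v : ℕ) : (s.setReg r v).arr = s.arr := rfl

@[simp] theorem State.setReg_tape (s : State) (r v : ℕ) : (s.setReg r v).tape = s.tape := rfl

@[simp] theorem State.setArr_reg (s : State) (a k v : ℕ) : (s.setArr a k v).reg = s.reg := rfl

@[simp] theorem State.setArr_arr (s : State) (a k v a' : ℕ) :
    (s.setArr a k v).arr a' = if a' = a then Function.update (s.arr a) k v else s.arr a' :=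
  Function.update_apply _ _ _ _

@[simp] theorem State.setArr_tape (s : State) (a k v : ℕ) : (s.setArr a k v).tape = s.tape := rfl

@[simp] theorem State.flipInto_reg (s : State) (r r' : ℕ) :
    (s.flipInto r).reg r' = if r' = r then (s.tape 0).toNat else s.reg r' :=
  Function.update_apply _ _ _ _

@[simp] theorem State.flipInto_arr (s : State) (r : ℕ) : (s.flipInto r).arr = s.arr := rfl

@[simp] theorem State.flipInto_tape (s : State) (r : ℕ) :
    (s.flipInto r).tape = fun k => s.tape (k + 1) := rfl

/-- The program never writes to register `r`. -/
def Prog.keepsReg (r : ℕ) : Prog → Bool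
  | .skip => true
  | .assign r' _ => r' != r
  | .store _ _ _ => true
  | .flip r' => r' != r
  | .decode _ _ => true
  | .seq p q => p.keepsReg r && q.keepsReg r
  | .ite _ p q => p.keepsReg r && q.keepsReg r
  | .loop _ p => p.keepsReg r

/-- The program never writes to array `a`. -/
def Prog.keepsArr (a : ℕ) : Prog → Bool
  | .skip => true
  | .assign _ _ => true
  | .store a' _ _ => a' != a
  | .flip _ => true
  | .decode _ b => b != a
  | .seq p q => p.keepsArr a && q.keepsArr a
  | .ite _ p q => p.keepsArr a && q.keepsArr a
  | .loop _ p => p.keepsArr a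

/-- The program never reads the random tape. -/
def Prog.keepsTape : Prog → Bool
  | .skip => true
  | .assign _ _ => true
  | .store _ _ _ => true
  | .flip _ => false
  | .decode _ _ => true
  | .seq p q => p.keepsTape && q.keepsTape
  | .ite _ p q => p.keepsTape && q.keepsTape
  | .loop _ p => p.keepsTape

/-- What the program `p` never touches is the same in `s` and `s'`. -/
structure Frame (p : Prog) (s s' : State) : Prop where
  reg : ∀ r, p.keepsReg r = true → s'.reg r = s.reg r
  arr : ∀ a, p.keepsArr a = true → s'.arr a = s.arr a
  tape : p.keepsTape = true → s'.tape = s.tape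

theorem Frame.refl (p : Prog) (s : State) : Frame p s s :=
  ⟨fun _ _ => rfl, fun _ _ => rfl, fun _ => rfl⟩

theorem Frame.trans {p : Prog} {s s' s'' : State} (h : Frame p s s') (h' : Frame p s' s'') :
    Frame p s s'' :=
  ⟨fun r hr => (h'.reg r hr).trans (h.reg r hr), fun a ha => (h'.arr a ha).trans (h.arr a ha),
    fun ht => (h'.tape ht).trans (h.tape ht)⟩

theorem Frame.weaken {p q : Prog} {s s' : State} (h : Frame p s s')
    (hr : ∀ r, q.keepsReg r = true → p.keepsReg r = true)
    (ha : ∀ a, q.keepsArr a = true → p.keepsArr a = true)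
    (ht : q.keepsTape = true → p.keepsTape = true) : Frame q s s' :=
  ⟨fun r h' => h.reg r (hr r h'), fun a h' => h.arr a (ha a h'), fun h' => h.tape (ht h')⟩

variable {m : ℕ} {dec : Option (BinWord m → BinWord m)}

/-- What a run leaves unchanged is decided by the program text, so for concrete programs the side
conditions hold by `rfl`. -/
theorem Exec.frame {p : Prog} {s s' : State} {t : ℕ} (h : Exec dec p s t s') : Frame p s s' := by
  induction h with
  | skip s => exact .refl _ _
  | assign r e s =>
    refine ⟨fun r' hr => ?_, fun _ _ => rfl, fun _ => rfl⟩
    simp only [Prog.keepsReg, bne_iff_ne] at hr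
    simp [State.setReg, Function.update_of_ne hr.symm]
  | store a e₁ e₂ s =>
    refine ⟨fun _ _ => rfl, fun a' ha => ?_, fun _ => rfl⟩
    simp only [Prog.keepsArr, bne_iff_ne] at ha
    simp [State.setArr, Function.update_of_ne ha.symm]
  | flip r s =>
    refine ⟨fun r' hr => ?_, fun _ _ => rfl, fun h => by simp [Prog.keepsTape] at h⟩
    simp only [Prog.keepsReg, bne_iff_ne] at hr
    simp [State.flipInto, Function.update_of_ne hr.symm]
  | decode a b s D hD =>
    refine ⟨fun _ _ => rfl, fun a' ha => ?_, fun _ => rfl⟩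
    simp only [Prog.keepsArr, bne_iff_ne] at ha
    simp [State.writeWord, Function.update_of_ne ha.symm]
  | seq hp hq ihp ihq =>
    refine (ihp.weaken ?_ ?_ ?_).trans (ihq.weaken ?_ ?_ ?_) <;>
      simp +contextual [Prog.keepsReg, Prog.keepsArr, Prog.keepsTape]
  | iteTrue he hp ih =>
    refine ih.weaken ?_ ?_ ?_ <;> simp +contextual [Prog.keepsReg, Prog.keepsArr, Prog.keepsTape]
  | iteFalse he hp ih =>
    refine ih.weaken ?_ ?_ ?_ <;> simp +contextual [Prog.keepsReg, Prog.keepsArr, Prog.keepsTape]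
  | loopDone he => exact .refl _ _
  | loopStep he hp hl ihp ihl =>
    refine Frame.trans ?_ ihl
    exact ihp.weaken (fun _ => id) (fun _ => id) id

/-- Started in the bounded state `s`, the program `p` halts after at most `N` elementary steps, in a
bounded state that satisfies `Q`. -/
def Wp (dec : Option (BinWord m → BinWord m)) (W N : ℕ) (p : Prog) (Q : State → Prop)
    (s : State) : Prop :=
  Bounded W s → ∃ t s', Exec dec p s t s' ∧ t ≤ N * unitCost W ∧ Bounded W s' ∧ Q s'

/-! ### Hoare rules with step counts. -/

section rules

variable {W N N₁ N₂ : ℕ} {Q Q' : State → Prop} {s : State} {p q : Prog}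

/-- The frame is handed to the consequence, so a postcondition only has to describe what the program
changes. -/
theorem Wp.mono (h : Wp dec W N p Q s) (hQ : ∀ s', Frame p s s' → Q s' → Q' s') :
    Wp dec W N p Q' s := by
  intro hs
  obtain ⟨t, s', h1, h2, h3, h4⟩ := h hs
  exact ⟨t, s', h1, h2, h3, hQ _ h1.frame h4⟩

theorem Wp.bounded (h : Wp dec W N p Q s) :
    Wp dec W N p (fun s' => Bounded W s' ∧ Q s') s := by
  intro hs
  obtain ⟨t, s', h1, h2, h3, h4⟩ := h hs
  exact ⟨t, s', h1, h2, h3, h3, h4⟩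

theorem Wp.steps_mono (h : Wp dec W N₁ p Q s) (hN : N₁ ≤ N₂) : Wp dec W N₂ p Q s := by
  intro hs
  obtain ⟨t, s', h1, h2, h3, h4⟩ := h hs
  exact ⟨t, s', h1, h2.trans (Nat.mul_le_mul_right _ hN), h3, h4⟩

theorem Wp.skip (h : Q s) : Wp dec W 1 .skip Q s := by
  intro hs
  exact ⟨1, s, .skip s, by unfold unitCost; omega, hs, h⟩

theorem Bounded.setReg (hs : Bounded W s) {r v : ℕ} (hv : v < 2 ^ W) :
    Bounded W (s.setReg r v) := by
  refine ⟨fun r' => ?_, hs.2⟩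
  by_cases h : r' = r
  · subst h; simpa [State.setReg] using hv
  · simpa [State.setReg, Function.update_of_ne h] using hs.1 r'

theorem Wp.assign (hW : 1 ≤ W) {r : ℕ} {e : Exp} (he : e.weight ≤ 20) (hv : e.eval s < 2 ^ W)
    (h : Q (s.setReg r (e.eval s))) : Wp dec W 1 (.assign r e) Q s := by
  intro hs
  refine ⟨_, _, .assign r e s, ?_, hs.setReg hv, h⟩
  have := e.cost_le_unit hW hs he
  omega

theorem Wp.store (hW : 1 ≤ W) {a : ℕ} {e₁ e₂ : Exp} (he₁ : e₁.weight ≤ 20) (he₂ : e₂.weight ≤ 20)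
    (hv : e₂.eval s < 2 ^ W) (h : Q (s.setArr a (e₁.eval s) (e₂.eval s))) :
    Wp dec W 1 (.store a e₁ e₂) Q s := by
  intro hs
  refine ⟨_, _, .store a e₁ e₂ s, ?_, ⟨hs.1, fun a' k => ?_⟩, h⟩
  · have := e₁.cost_le_unit hW hs he₁
    have := e₂.cost_le_unit hW hs he₂
    omega
  · simp only [State.setArr, Function.update_apply]
    split_ifs
    · simp only [Function.update_apply]
      split_ifs
      · exact hv
      · exact hs.2 _ _
    · exact hs.2 _ _

theorem Wp.flip (hW : 1 ≤ W) {r : ℕ} (h : Q (s.flipInto r)) : Wp dec W 1 (.flip r) Q s := by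
  intro hs
  refine ⟨_, _, .flip r s, by unfold unitCost; omega, ⟨fun r' => ?_, hs.2⟩, h⟩
  have h1 : (s.tape 0).toNat < 2 ^ W :=
    (Bool.toNat_lt _).trans_le (Nat.pow_le_pow_right (n := 2) (by norm_num) hW)
  simp only [State.flipInto, Function.update_apply]
  split_ifs
  · exact h1
  · exact hs.1 _

theorem Wp.seq (h : Wp dec W N₁ p (Wp dec W N₂ q Q) s) : Wp dec W (N₁ + N₂) (.seq p q) Q s := by
  intro hs
  obtain ⟨t, s', h1, h2, h3, h4⟩ := h hs
  obtain ⟨t', s'', h1', h2', h3', h4'⟩ := h4 h3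
  exact ⟨_, _, .seq h1 h1', by rw [add_mul]; omega, h3', h4'⟩

theorem Wp.ite (hW : 1 ≤ W) {e : Exp} (he : e.weight ≤ 20)
    (h1 : e.eval s ≠ 0 → Wp dec W N p Q s) (h2 : e.eval s = 0 → Wp dec W N q Q s) :
    Wp dec W (N + 1) (.ite e p q) Q s := by
  intro hs
  have hc := e.cost_le_unit hW hs he
  by_cases h : e.eval s = 0
  · obtain ⟨t, s', a1, a2, a3, a4⟩ := h2 h hs
    exact ⟨_, _, .iteFalse h a1, by rw [add_mul]; omega, a3, a4⟩
  · obtain ⟨t, s', a1, a2, a3, a4⟩ := h1 h hs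
    exact ⟨_, _, .iteTrue h a1, by rw [add_mul]; omega, a3, a4⟩

/-- `for c := 0, …, bnd - 1 do body`. -/
def forLoop (c : ℕ) (bnd : Exp) (body : Prog) : Prog :=
  .seq (.assign c (.lit 0))
    (.loop (.lt (.var c) bnd) (.seq body (.assign c (.add (.var c) (.lit 1)))))

/-- Each iteration pays for the body, the guard and the increment; the final 2 pays for the
initialization and the last guard. The increment follows the body, so the next invariant is demanded
after the counter has been set to `k + 1`. -/
theorem Wp.forLoop (hW : 1 ≤ W) {c K : ℕ} {bnd : Exp} {body : Prog} (I : ℕ → State → Prop)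
    (hb : bnd.weight ≤ 15) (hK : K < 2 ^ W) (hc : body.keepsReg c = true)
    (hbnd : ∀ k ≤ K, ∀ s', Frame (forLoop c bnd body) s s' → I k s' → bnd.eval s' = K)
    (h0 : I 0 (s.setReg c 0))
    (hstep : ∀ k < K, ∀ s', Frame (RAM.forLoop c bnd body) s s' → s'.reg c = k → I k s' →
      Wp dec W N body (fun s'' => I (k + 1) (s''.setReg c (k + 1))) s')
    (hQ : ∀ s', Frame (RAM.forLoop c bnd body) s s' → I K s' → Q s') :
    Wp dec W (K * (N + 2) + 2) (RAM.forLoop c bnd body) Q s := by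
  intro hs
  have hw : (Exp.lt (.var c) bnd).weight ≤ 20 := by simp only [Exp.weight]; omega
  -- Induction on the number `j` of iterations that are still to come.
  have main : ∀ j ≤ K, ∀ s', Bounded W s' → Frame (RAM.forLoop c bnd body) s s' →
      s'.reg c = K - j → I (K - j) s' → ∃ t s'',
        Exec dec (.loop (.lt (.var c) bnd) (.seq body (.assign c (.add (.var c) (.lit 1)))))
            s' t s''
          ∧ t ≤ (j * (N + 2) + 1) * unitCost W ∧ Bounded W s'' ∧
          Frame (RAM.forLoop c bnd body) s s'' ∧ I K s'' := by
    intro j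
    induction j with
    | zero =>
      intro _ s' hs' hf hcs hI
      have hb' := hbnd K le_rfl s' hf (by simpa using hI)
      have he : (Exp.lt (.var c) bnd).eval s' = 0 := by
        simp [Exp.eval, hb', hcs]
      refine ⟨_, _, .loopDone he, ?_, hs', hf, by simpa using hI⟩
      have := (Exp.lt (.var c) bnd).cost_le_unit hW hs' hw
      simp only [zero_mul, zero_add, one_mul]
      omega
    | succ j ih =>
      intro hj s' hs' hf hcs hI
      have hb' := hbnd _ (Nat.sub_le _ _) s' hf hI
      have he : (Exp.lt (.var c) bnd).eval s' ≠ 0 := by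
        simp only [Exp.eval, hb', hcs]
        rw [if_pos (by omega)]
        exact one_ne_zero
      obtain ⟨t, s'', h1, h2, h3, h4⟩ := hstep (K - (j + 1)) (by omega) s' hf hcs hI hs'
      have e1 : K - (j + 1) + 1 = K - j := by omega
      have hc'' : s''.reg c = K - (j + 1) := (h1.frame.reg c hc).trans hcs
      have hev : (Exp.add (.var c) (.lit 1)).eval s'' = K - j := by
        simp only [Exp.eval, hc'']; omega
      have ha := Exec.assign (dec := dec) c (.add (.var c) (.lit 1)) s''
      have hfr : Frame (RAM.forLoop c bnd body) s (s''.setReg c (K - j)) := by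
        refine hf.trans ?_
        have hf2 := (Exec.seq h1 ha).frame
        rw [hev] at hf2
        refine hf2.weaken ?_ ?_ ?_ <;>
          simp +contextual [RAM.forLoop, Prog.keepsReg, Prog.keepsArr, Prog.keepsTape]
      have hbd : Bounded W (s''.setReg c (K - j)) := h3.setReg (by omega)
      obtain ⟨t', s₃, g1, g2, g3, g4, g5⟩ := ih (by omega) _ hbd hfr (by simp [State.setReg])
        (by rw [← e1]; exact h4)
      have hcost := (Exp.add (.var c) (.lit 1)).cost_le_unit hW h3 (by simp [Exp.weight])
      have hcost' := (Exp.lt (.var c) bnd).cost_le_unit hW hs' hw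
      rw [hev] at ha
      refine ⟨_, _, .loopStep he (.seq h1 ha) g1, ?_, g3, g4, g5⟩
      have : ((j + 1) * (N + 2) + 1) * unitCost W =
          (j * (N + 2) + 1) * unitCost W + N * unitCost W + 2 * unitCost W := by ring
      rw [this]
      omega
  have h0' := Exec.assign (dec := dec) c (.lit 0) s
  have hfr : Frame (RAM.forLoop c bnd body) s (s.setReg c 0) := by
    refine h0'.frame.weaken ?_ ?_ ?_ <;>
      simp +contextual [RAM.forLoop, Prog.keepsReg, Prog.keepsArr, Prog.keepsTape]
  obtain ⟨t, s', h1, h2, h3, h4, h5⟩ := main K le_rfl (s.setReg c 0)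
    (hs.setReg (by positivity)) hfr (by simp [State.setReg]) (by simpa using h0)
  refine ⟨_, _, .seq h0' h1, ?_, h3, hQ _ h4 h5⟩
  have hcost := (Exp.lit 0).cost_le_unit hW hs (by simp [Exp.weight])
  have : (K * (N + 2) + 2) * unitCost W = (K * (N + 2) + 1) * unitCost W + unitCost W := by ring
  rw [this]
  omega

end rules

end RAM

namespace ClosestPair

open RAM

/-! ### The algorithm

Every repetition draws a random partial word: each coordinate is fixed to `0`, fixed to `1`, or
left free. The points that agree on the free coordinates fall into one bucket, and a bucket
remembers only points at distance at most `d / 2` from the partial word on the fixed coordinates. -/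

/-- Registers: `0`, `1`, `2` hold `n`, `m`, `d`; `3` gets `2 ^ (m + 2)`. -/
def powProg : Prog :=
  .seq (.assign 3 (.lit 1))
    (forLoop 9 (.add (.var 1) (.lit 2)) (.assign 3 (.mul (.lit 2) (.var 3))))

/-- Register `4` gets the number of outcomes that fix a coordinate to a given value. -/
def thresholdProg : Prog :=
  .seq
    -- Adding m - 1 rounds the quotient up, so before the cap at P/2 it is at least δP, and it is
    -- positive for d > 0.
    (.assign 4 (.div (.add (.mul (.var 3) (.var 2)) (.sub (.var 1) (.lit 1))) (.var 1)))
    (.ite (.lt (.div (.var 3) (.lit 2)) (.var 4)) (.assign 4 (.div (.var 3) (.lit 2))) .skip)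

/-- Registers `5` and `6` get the numerator and the denominator of the number of repetitions. -/
def ratioProg : Prog :=
  .seq (.assign 5 (.lit 1)) (.seq (.assign 6 (.lit 1))
    (forLoop 9 (.var 1) (.seq (.assign 5 (.mul (.var 5) (.var 3)))
      (.ite (.lt (.var 9) (.var 2))
        (.assign 6 (.mul (.var 6) (.mul (.lit 2) (.var 4))))
        (.assign 6 (.mul (.var 6) (.sub (.var 3) (.var 4))))))))

/-- Register `7` gets the number of repetitions. -/
def repsProg : Prog :=
  .assign 7 (.add (.div (.mul (.mul (.lit 2) (.mul (.add (.var 1) (.lit 1))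
    (.add (.var 1) (.lit 1)))) (.var 5)) (.var 6)) (.lit 1))

/-- Register `10` gets `m + 2` random bits. -/
def drawNumber : Prog :=
  .seq (.assign 10 (.lit 0))
    (forLoop 11 (.add (.var 1) (.lit 2)) (.seq (.flip 12)
      (.assign 10 (.add (.mul (.lit 2) (.var 10)) (.var 12)))))

/-- Array `1` gets a random partial word, in which `2` stands for a free coordinate. -/
def drawProg : Prog :=
  forLoop 9 (.var 1) (.seq drawNumber
    (.store 1 (.var 9) (.sub (.sub (.lit 2) (.lt (.var 10) (.var 4)))
      (.lt (.var 10) (.mul (.lit 2) (.var 4))))))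

/-- Registers `14` and `15` get the bucket of point number `reg 13` and its distance from the
partial word. -/
def keyProg : Prog :=
  .seq (.assign 14 (.lit 0)) (.seq (.assign 15 (.lit 0))
    (forLoop 9 (.var 1)
      (.seq (.assign 12 (.get 0 (.add (.mul (.var 13) (.var 1)) (.var 9))))
      (.seq (.assign 14 (.add (.mul (.lit 2) (.var 14))
        (.mul (.var 12) (.eq (.get 1 (.var 9)) (.lit 2)))))
        -- The difference is 1 exactly at a fixed coordinate that disagrees: the free entry 2 equals
        -- no bit and contributes 0 - 0.
        (.assign 15 (.add (.var 15) (.sub (.lt (.get 1 (.var 9)) (.lit 2))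
          (.eq (.get 1 (.var 9)) (.var 12)))))))))

/-- Register `17` gets the distance of the points number `reg 13` and `reg 16`. -/
def distProg : Prog :=
  .seq (.assign 17 (.lit 0))
    (forLoop 9 (.var 1) (.assign 17 (.add (.var 17) (.sub (.lit 1)
      (.eq (.get 0 (.add (.mul (.var 13) (.var 1)) (.var 9)))
        (.get 0 (.add (.mul (.var 16) (.var 1)) (.var 9))))))))

/-- Compare point number `reg 13` with the point in its bucket, and put it into the bucket. -/
def pointProg : Prog :=
  .seq keyProg (.seq (.assign 16 (.get 2 (.var 14))) (.seq distProg (.seq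
    -- The product is a conjunction. Its second factor excludes a point meeting itself in the table,
    -- which would pass the distance test when d = 0.
    (.ite (.mul (.eq (.var 17) (.var 2)) (.sub (.lit 1) (.eq (.var 16) (.var 13))))
      (.seq (.assign 18 (.var 13)) (.assign 19 (.var 16))) .skip)
    (.ite (.lt (.div (.var 2) (.lit 2)) (.var 15)) .skip (.store 2 (.var 14) (.var 13))))))

/-- One repetition. -/
def roundProg : Prog := .seq drawProg (forLoop 13 (.var 0) pointProg)

/-- The algorithm. It does not need the black-box decoder: for `2 d ≤ m` its running time has the
exponential factor `2 ^ ((H₂(δ) - δ) m)` anyway, and for `2 d > m` codes that meet the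
Gilbert-Varshamov bound exist only if `2 ^ ((H₂(δ) - δ) m)` is about `2 ^ ((1 - δ) m)`. -/
def mainProg : Prog :=
  .seq powProg (.seq thresholdProg (.seq ratioProg (.seq repsProg
    (.seq (forLoop 8 (.var 7) roundProg) (.seq (.assign 0 (.var 18)) (.assign 1 (.var 19)))))))

/-! ### What the pieces of the algorithm compute -/

/-- The number with the binary digits `f 0, …, f (l - 1)`. -/
def bitsVal (f : ℕ → Bool) : ℕ → ℕ
  | 0 => 0
  | l + 1 => 2 * bitsVal f l + (f l).toNat

theorem bitsVal_lt (f : ℕ → Bool) (l : ℕ) : bitsVal f l < 2 ^ l := by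
  induction l with
  | zero => simp [bitsVal]
  | succ l ih =>
    have := Bool.toNat_le (f l)
    simp only [bitsVal, pow_succ]
    omega

theorem bitsVal_inj {f g : ℕ → Bool} {l : ℕ} (h : bitsVal f l = bitsVal g l) :
    ∀ k < l, f k = g k := by
  induction l with
  | zero => simp
  | succ l ih =>
    simp only [bitsVal] at h
    have hf := Bool.toNat_le (f l)
    have hg := Bool.toNat_le (g l)
    intro k hk
    rcases Nat.lt_succ_iff_lt_or_eq.1 hk with hk | rfl
    · exact ih (by omega) k hk
    · have : (f k).toNat = (g k).toNat := by omega
      cases hfk : f k <;> cases hgk : g k <;> simp_all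

theorem bitsVal_congr {f g : ℕ → Bool} {l : ℕ} (h : ∀ k < l, f k = g k) :
    bitsVal f l = bitsVal g l := by
  induction l with
  | zero => rfl
  | succ l ih =>
    simp only [bitsVal]
    rw [ih fun k hk => h k (by omega), h l (by omega)]

/-- The number of outcomes that fix a coordinate to a given value, out of `2 ^ (m + 2)`. -/
def threshold (m d : ℕ) : ℕ := min ((2 ^ (m + 2) * d + (m - 1)) / m) (2 ^ (m + 1))

/-- `(2 a) ^ d (2 ^ (m + 2) - a) ^ (m - d)` for the threshold `a`, as a product. -/
def denom (m d k : ℕ) : ℕ :=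
  ∏ j ∈ Finset.range k, if j < d then 2 * threshold m d else 2 ^ (m + 2) - threshold m d

/-- The number of repetitions. -/
def reps (m d : ℕ) : ℕ := 2 * ((m + 1) * (m + 1)) * (2 ^ (m + 2)) ^ m / denom m d m + 1

/-- The entry of the partial word that belongs to the random number `u`. -/
def cell (a u : ℕ) : ℕ := 2 - (if u < a then 1 else 0) - (if u < 2 * a then 1 else 0)

/-- The random number that is read from the tape `τ` for coordinate `k`. -/
def drawn (m : ℕ) (τ : ℕ → Bool) (k : ℕ) : ℕ :=
  bitsVal (fun l => τ (k * (m + 2) + l)) (m + 2)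

/-- The bucket of the word `y`. -/
def bucket (m : ℕ) (st : ℕ → ℕ) (y : ℕ → Bool) : ℕ :=
  bitsVal (fun k => y k && decide (st k = 2)) m

/-- The distance of the word `y` from the partial word `st` on the fixed coordinates. -/
def fixedDist (m : ℕ) (st : ℕ → ℕ) (y : ℕ → Bool) : ℕ :=
  ∑ k ∈ Finset.range m, ((if st k < 2 then 1 else 0) - (if st k = (y k).toNat then 1 else 0))

/-- The Hamming distance of the first `m` entries. -/
def dist (m : ℕ) (y y' : ℕ → Bool) : ℕ :=
  ∑ k ∈ Finset.range m, (1 - (if (y k).toNat = (y' k).toNat then 1 else 0))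

/-- A bound for the bit lengths of all numbers that occur. -/
def width (m : ℕ) : ℕ := (m + 5) ^ 2

theorem one_le_width (m : ℕ) : 1 ≤ width m := Nat.one_le_pow _ _ (by omega)

theorem two_pow_lt_width {m e : ℕ} (he : e ≤ m * (m + 2) + 2 * m + 5) :
    2 ^ e < 2 ^ width m := by
  refine Nat.pow_lt_pow_right (by norm_num) ?_
  unfold width
  nlinarith

theorem le_two_pow_lt_width {m v : ℕ} (hv : v ≤ 2 ^ (m * (m + 2) + 2 * m + 5)) :
    v < 2 ^ width m := hv.trans_lt (two_pow_lt_width le_rfl)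

end ClosestPair

/-! ### Computing the parameters: powers, threshold, number of repetitions. -/

namespace ClosestPair

open RAM

variable {m : ℕ} {dec : Option (BinWord m → BinWord m)} {s : State}

theorem wp_powProg (h1 : s.reg 1 = m) :
    Wp dec (width m) (3 * (m + 2) + 3) powProg (fun s' => s'.reg 3 = 2 ^ (m + 2)) s := by
  have hW := one_le_width m
  refine Wp.steps_mono (Wp.seq (N₁ := 1) (N₂ := (m + 2) * (1 + 2) + 2) ?_) (by omega)
  refine .assign hW (by decide) (Nat.one_lt_two_pow (by omega)) ?_
  refine Wp.forLoop hW (fun k s' => s'.reg 3 = 2 ^ k) (by decide) ?_ rfl ?_ ?_ ?_ ?_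
  · exact le_two_pow_lt_width (Nat.lt_two_pow_self.le.trans
      (Nat.pow_le_pow_right (by norm_num) (by nlinarith)))
  · intro k hk s' hf hI
    have := hf.reg 1 rfl
    simp_all [Exp.eval]
  · simp [Exp.eval]
  · intro k hk s' hf hc hI
    have hv : (Exp.mul (.lit 2) (.var 3)).eval s' = 2 ^ (k + 1) := by
      simp [Exp.eval, hI, pow_succ, mul_comm]
    refine .assign hW (by decide) ?_ ?_
    · rw [hv]; exact two_pow_lt_width (by nlinarith)
    · simp [hv]
  · intro s' hf hI
    exact hI

theorem threshold_le (m d : ℕ) : 2 * threshold m d ≤ 2 ^ (m + 2) := by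
  have : threshold m d ≤ 2 ^ (m + 1) := min_le_right _ _
  rw [pow_succ]; omega

theorem wp_thresholdProg {d : ℕ} (hm : 0 < m) (hd : d ≤ m) (h1 : s.reg 1 = m) (h2 : s.reg 2 = d)
    (h3 : s.reg 3 = 2 ^ (m + 2)) :
    Wp dec (width m) 3 thresholdProg (fun s' => s'.reg 4 = threshold m d) s := by
  have hW := one_le_width m
  have h42 : 2 ^ (m + 2) / 2 = 2 ^ (m + 1) := by rw [pow_succ]; omega
  refine Wp.seq (N₁ := 1) (N₂ := 2) (.assign hW (by decide) ?_ (.ite (N := 1) hW (by decide) ?_ ?_))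
  · simp only [Exp.eval, h1, h2, h3]
    refine le_two_pow_lt_width ?_
    calc (2 ^ (m + 2) * d + (m - 1)) / m ≤ (2 ^ (m + 2) * m + m) / m :=
          Nat.div_le_div_right (by gcongr; omega)
      _ = 2 ^ (m + 2) + 1 := by
        rw [show 2 ^ (m + 2) * m + m = (2 ^ (m + 2) + 1) * m by ring, Nat.mul_div_cancel _ hm]
      _ ≤ 2 ^ (m + 3) := by have := Nat.one_le_two_pow (n := m + 2); rw [pow_succ 2 (m + 2)]; omega
      _ ≤ _ := Nat.pow_le_pow_right (by norm_num) (by nlinarith)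
  · intro h
    refine .assign hW (by decide) ?_ ?_
    · simp only [Exp.eval, h3, State.setReg_reg]
      simpa [h3, h42] using two_pow_lt_width (m := m) (e := m + 1) (by nlinarith)
    · simp [Exp.eval, h1, h2, h3, h42] at h ⊢
      exact (min_eq_right h.le).symm
  · intro h
    refine .skip ?_
    simp [Exp.eval, h1, h2, h3, h42] at h ⊢
    exact (min_eq_left h).symm

theorem denom_le (m d k : ℕ) : denom m d k ≤ (2 ^ (m + 2)) ^ k := by
  have := threshold_le m d
  refine (Finset.prod_le_pow_card _ _ (2 ^ (m + 2)) fun j _ => ?_).trans_eq (by simp)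
  split_ifs <;> omega

theorem pow_pow_lt_width {v k m : ℕ} (hk : k ≤ m) (h : v ≤ (2 ^ (m + 2)) ^ k) :
    v < 2 ^ width m := by
  refine h.trans_lt ?_
  rw [← pow_mul]
  exact two_pow_lt_width (by nlinarith)

theorem wp_ratioProg {d : ℕ} (h1 : s.reg 1 = m) (h2 : s.reg 2 = d) (h3 : s.reg 3 = 2 ^ (m + 2))
    (h4 : s.reg 4 = threshold m d) :
    Wp dec (width m) (5 * m + 4) ratioProg
      (fun s' => s'.reg 5 = (2 ^ (m + 2)) ^ m ∧ s'.reg 6 = denom m d m) s := by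
  have hW := one_le_width m
  refine Wp.steps_mono (Wp.seq (N₁ := 1) (N₂ := 1 + (m * (3 + 2) + 2)) ?_) (by omega)
  refine .assign hW (by decide) (Nat.one_lt_two_pow (by omega)) (.seq ?_)
  refine .assign hW (by decide) (Nat.one_lt_two_pow (by omega)) ?_
  refine Wp.forLoop hW
    (fun k s' => s'.reg 5 = (2 ^ (m + 2)) ^ k ∧ s'.reg 6 = denom m d k) (by decide) ?_ rfl
    ?_ ?_ ?_ ?_
  · exact le_two_pow_lt_width (Nat.lt_two_pow_self.le.trans
      (Nat.pow_le_pow_right (by norm_num) (by nlinarith)))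
  · intro k hk s' hf hI
    have := hf.reg 1 rfl
    simp_all [Exp.eval]
  · simp [Exp.eval, denom]
  · rintro k hk s' hf hc ⟨h5, h6⟩
    have g2 : s'.reg 2 = d := by rw [hf.reg 2 rfl]; simpa using h2
    have g3 : s'.reg 3 = 2 ^ (m + 2) := by rw [hf.reg 3 rfl]; simpa using h3
    have g4 : s'.reg 4 = threshold m d := by rw [hf.reg 4 rfl]; simpa using h4
    have hden := denom_le m d (k + 1)
    rw [denom, Finset.prod_range_succ, ← denom] at hden
    refine .seq (N₁ := 1) (N₂ := 2) (.assign hW (by decide) ?_ (.ite (N := 1) hW (by decide) ?_ ?_))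
    · simp only [Exp.eval, h5, g3, ← pow_succ]
      exact pow_pow_lt_width (k := k + 1) hk le_rfl
    · intro h
      simp [Exp.eval, g2, hc] at h
      rw [if_pos h] at hden
      refine .assign hW (by decide) ?_ ?_
      · simpa [Exp.eval, g4, h6] using pow_pow_lt_width (k := k + 1) hk hden
      · simp [Exp.eval, h5, g3, pow_succ, h6, g4, denom, Finset.prod_range_succ, h]
    · intro h
      simp [Exp.eval, g2, hc] at h
      rw [if_neg (by omega)] at hden
      refine .assign hW (by decide) ?_ ?_
      · simpa [Exp.eval, g4, h6, g3] using pow_pow_lt_width (k := k + 1) hk hden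
      · simp [Exp.eval, h5, g3, pow_succ, h6, g4, denom, Finset.prod_range_succ,
          if_neg (not_lt.2 h)]
  · intro s' hf hI
    exact hI

theorem reps_lt (m d : ℕ) : reps m d < 2 ^ width m := by
  refine le_two_pow_lt_width ?_
  have h1 : m + 1 ≤ 2 ^ m := Nat.lt_two_pow_self
  calc reps m d ≤ 2 * (2 ^ m * 2 ^ m) * (2 ^ (m + 2)) ^ m + 1 := by
        unfold reps
        -- Bounding m + 1 by 2^m turns the count into a power of two; it is the number that
        -- determines the choice of `width`.
        gcongr
        exact (Nat.div_le_self _ _).trans (by gcongr)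
    _ = 2 ^ (m * (m + 2) + 2 * m + 1) + 1 := by
        rw [← pow_mul]; ring
    _ ≤ 2 ^ (m * (m + 2) + 2 * m + 1) * 2 ^ 4 := by
        have := Nat.one_le_two_pow (n := m * (m + 2) + 2 * m + 1)
        omega
    _ = _ := by rw [← pow_add]

theorem wp_repsProg {d : ℕ} (h1 : s.reg 1 = m) (h5 : s.reg 5 = (2 ^ (m + 2)) ^ m)
    (h6 : s.reg 6 = denom m d m) :
    Wp dec (width m) 1 repsProg (fun s' => s'.reg 7 = reps m d) s := by
  have hv : (Exp.add (.div (.mul (.mul (.lit 2) (.mul (.add (.var 1) (.lit 1))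
      (.add (.var 1) (.lit 1)))) (.var 5)) (.var 6)) (.lit 1)).eval s = reps m d := by
    simp [Exp.eval, h1, h5, h6, reps]
  refine .assign (one_le_width m) (by decide) ?_ ?_
  · rw [hv]; exact reps_lt m d
  · rw [hv]; simp

end ClosestPair

/-! ### Drawing a partial word and processing one point. -/

namespace ClosestPair

open RAM

variable {m : ℕ} {dec : Option (BinWord m → BinWord m)} {s : State}

theorem le_lt_width {v m : ℕ} (h : v ≤ m + 2) : v < 2 ^ width m :=
  le_two_pow_lt_width (Nat.lt_two_pow_self.le.trans
    (Nat.pow_le_pow_right (by norm_num) (by nlinarith)))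

theorem wp_drawNumber {τ : ℕ → Bool} (h1 : s.reg 1 = m) (hτ : s.tape = τ) :
    Wp dec (width m) (4 * m + 11) drawNumber (fun s' => s'.reg 10 = bitsVal τ (m + 2) ∧
      s'.tape = fun l => τ (m + 2 + l)) s := by
  have hW := one_le_width m
  refine Wp.steps_mono (Wp.seq (N₁ := 1) (N₂ := (m + 2) * (2 + 2) + 2) ?_) (by omega)
  refine .assign hW (by decide) (by simp [Exp.eval]) ?_
  refine Wp.forLoop hW (fun k s' => s'.reg 10 = bitsVal τ k ∧ s'.tape = fun l => τ (k + l))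
    (by decide) (le_lt_width le_rfl) rfl ?_ ?_ ?_ ?_
  · intro k hk s' hf hI
    have := hf.reg 1 rfl
    simp_all [Exp.eval]
  · simp [Exp.eval, bitsVal, hτ]
  · rintro k hk s' hf hc ⟨h10, ht⟩
    refine .seq (N₁ := 1) (N₂ := 1) (.flip hW ?_)
    have hv : (Exp.add (.mul (.lit 2) (.var 10)) (.var 12)).eval (s'.flipInto 12) =
        bitsVal τ (k + 1) := by
      simp [Exp.eval, h10, ht, bitsVal]
    refine .assign hW (by decide) ?_ ?_
    · rw [hv]
      exact (bitsVal_lt _ _).trans (two_pow_lt_width (by nlinarith))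
    · simp only [hv, State.setReg_reg, State.setReg_tape, State.flipInto_tape, ht]
      refine ⟨by simp, ?_⟩
      funext l
      congr 1
      ring
  · exact fun s' hf hI => hI

theorem cell_le (a u : ℕ) : cell a u ≤ 2 := by
  unfold cell; omega

theorem wp_drawProg {d : ℕ} {τ : ℕ → Bool} (h1 : s.reg 1 = m) (h4 : s.reg 4 = threshold m d)
    (hτ : s.tape = τ) :
    Wp dec (width m) (m * (4 * m + 14) + 2) drawProg
      (fun s' => (∀ k < m, s'.arr 1 k = cell (threshold m d) (drawn m τ k)) ∧
        s'.tape = fun l => τ (m * (m + 2) + l)) s := by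
  have hW := one_le_width m
  refine Wp.forLoop (N := 4 * m + 12) hW
    (fun k s' => (∀ j < k, s'.arr 1 j = cell (threshold m d) (drawn m τ j)) ∧
        s'.tape = fun l => τ (k * (m + 2) + l)) (by decide) (le_lt_width (by omega)) rfl ?_ ?_ ?_ ?_
  · intro k hk s' hf hI
    rw [← h1]
    exact hf.reg 1 rfl
  · simp [hτ]
  · rintro k hk s' hf hc ⟨hst, ht⟩
    have g1 : s'.reg 1 = m := (hf.reg 1 rfl).trans h1
    refine .seq (N₁ := 4 * m + 11) (N₂ := 1) ((wp_drawNumber g1 ht).mono ?_)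
    rintro s'' hf' ⟨h10, ht'⟩
    have g4 : s''.reg 4 = threshold m d := (hf'.reg 4 rfl).trans ((hf.reg 4 rfl).trans h4)
    have g9 : s''.reg 9 = k := (hf'.reg 9 rfl).trans hc
    have ga : s''.arr 1 = s'.arr 1 := hf'.arr 1 rfl
    have hv : (Exp.sub (.sub (.lit 2) (.lt (.var 10) (.var 4)))
        (.lt (.var 10) (.mul (.lit 2) (.var 4)))).eval s'' =
        cell (threshold m d) (drawn m τ k) := by
      simp only [Exp.eval, h10, g4, cell, drawn]
      rfl
    refine .store hW (by decide) (by decide) ?_ ?_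
    · rw [hv]
      exact le_lt_width ((cell_le _ _).trans (by omega))
    · rw [hv]
      constructor
      · intro j hj
        simp only [Exp.eval, g9, State.setReg_arr, State.setArr_arr, if_true, ga,
          Function.update_apply]
        split_ifs with h
        · rw [h]
        · exact hst j (by omega)
      · simp only [State.setReg_tape, State.setArr_tape, ht']
        funext l
        congr 1
        ring
  · exact fun s' hf hI => hI

/-- The registers and cells that hold the input and the parameters of the algorithm. -/
structure Env (n m d : ℕ) (X : ℕ → ℕ → Bool) (s : State) : Prop where
  reg_zero : s.reg 0 = n
  reg_one : s.reg 1 = m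
  reg_two : s.reg 2 = d
  reg_four : s.reg 4 = threshold m d
  input : ∀ i < n, ∀ k < m, s.arr 0 (i * m + k) = (X i k).toNat

variable {n d : ℕ} {X : ℕ → ℕ → Bool}

theorem Env.frame {p : Prog} {s' : State} (h : Env n m d X s) (hf : Frame p s s')
    (h0 : p.keepsReg 0 = true := by rfl) (h1 : p.keepsReg 1 = true := by rfl)
    (h2 : p.keepsReg 2 = true := by rfl) (h4 : p.keepsReg 4 = true := by rfl)
    (ha : p.keepsArr 0 = true := by rfl) : Env n m d X s' :=
  ⟨(hf.reg 0 h0).trans h.reg_zero, (hf.reg 1 h1).trans h.reg_one, (hf.reg 2 h2).trans h.reg_two,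
    (hf.reg 4 h4).trans h.reg_four, by rw [hf.arr 0 ha]; exact h.input⟩

theorem fixedDist_le (m : ℕ) (st : ℕ → ℕ) (y : ℕ → Bool) : fixedDist m st y ≤ m := by
  refine (Finset.sum_le_card_nsmul _ _ 1 fun k _ => ?_).trans (by simp)
  split_ifs <;> omega

theorem dist_le (m : ℕ) (y y' : ℕ → Bool) : dist m y y' ≤ m := by
  refine (Finset.sum_le_card_nsmul _ _ 1 fun k _ => ?_).trans (by simp)
  omega

theorem wp_keyProg (hs : Env n m d X s) {i : ℕ} (hi : i < n) (h13 : s.reg 13 = i) :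
    Wp dec (width m) (5 * m + 4) keyProg (fun s' => s'.reg 14 = bucket m (s.arr 1) (X i) ∧
      s'.reg 15 = fixedDist m (s.arr 1) (X i)) s := by
  have hW := one_le_width m
  refine Wp.steps_mono (Wp.seq (N₁ := 1) (N₂ := 1 + (m * (3 + 2) + 2)) ?_) (by omega)
  refine .assign hW (by decide) (by simp [Exp.eval]) (.seq ?_)
  refine .assign hW (by decide) (by simp [Exp.eval]) ?_
  refine Wp.forLoop hW (fun k s' => s'.reg 14 = bucket k (s.arr 1) (X i) ∧
      s'.reg 15 = fixedDist k (s.arr 1) (X i)) (by decide) (le_lt_width (by omega)) rfl ?_ ?_ ?_ ?_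
  · intro k hk s' hf hI
    have := hf.reg 1 rfl
    simp_all [Exp.eval, hs.reg_one]
  · simp [Exp.eval, bucket, bitsVal, fixedDist]
  · rintro k hk s' hf hc ⟨h14, h15⟩
    have g1 : s'.reg 1 = m := by rw [hf.reg 1 rfl]; simpa using hs.reg_one
    have g13 : s'.reg 13 = i := by rw [hf.reg 13 rfl]; simpa using h13
    have a0 : s'.arr 0 (i * m + k) = (X i k).toNat := by
      rw [hf.arr 0 rfl]; simpa using hs.input i hi k hk
    have a1 : s'.arr 1 = s.arr 1 := hf.arr 1 rfl
    have e1 : (Exp.get 0 (.add (.mul (.var 13) (.var 1)) (.var 9))).eval s' = (X i k).toNat := by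
      simp [Exp.eval, g1, g13, hc, a0]
    refine .seq (N₁ := 1) (N₂ := 2) (.assign hW (by decide) ?_ (.seq (N₁ := 1) (N₂ := 1)
      (.assign hW (by decide) ?_ (.assign hW (by decide) ?_ ?_))))
    · rw [e1]
      exact le_lt_width ((Bool.toNat_le _).trans (by omega))
    all_goals rw [e1]
    · refine lt_of_le_of_lt (le_of_eq ?_) ((bitsVal_lt
        (fun k => X i k && decide (s.arr 1 k = 2)) (k + 1)).trans (two_pow_lt_width (m := m)
          (by nlinarith)))
      simp only [Exp.eval, State.setReg_reg, State.setReg_arr, a1, h14, hc, bucket, bitsVal]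
      cases X i k <;> by_cases h2 : s.arr 1 k = 2 <;> simp [h2]
    · refine lt_of_le_of_lt (le_of_eq ?_) (le_lt_width (m := m)
        ((fixedDist_le (k + 1) (s.arr 1) (X i)).trans (by omega)))
      simp [Exp.eval, a1, h15, hc, fixedDist, Finset.sum_range_succ]
    · constructor
      · simp only [Exp.eval, State.setReg_reg, State.setReg_arr, a1, h14, hc, bucket, bitsVal]
        cases X i k <;> by_cases h2 : s.arr 1 k = 2 <;> simp [h2]
      · simp [Exp.eval, a1, h15, hc, fixedDist, Finset.sum_range_succ]
  · exact fun s' hf hI => hI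

theorem wp_distProg (hs : Env n m d X s) {i j : ℕ} (hi : i < n) (hj : j < n) (h13 : s.reg 13 = i)
    (h16 : s.reg 16 = j) :
    Wp dec (width m) (3 * m + 3) distProg (fun s' => s'.reg 17 = dist m (X i) (X j)) s := by
  have hW := one_le_width m
  refine Wp.steps_mono (Wp.seq (N₁ := 1) (N₂ := m * (1 + 2) + 2) ?_) (by omega)
  refine .assign hW (by decide) (by simp [Exp.eval]) ?_
  refine Wp.forLoop hW (fun k s' => s'.reg 17 = dist k (X i) (X j)) (by decide)
    (le_lt_width (by omega)) rfl ?_ ?_ ?_ ?_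
  · intro k hk s' hf hI
    have := hf.reg 1 rfl
    simp_all [Exp.eval, hs.reg_one]
  · simp [Exp.eval, dist]
  · intro k hk s' hf hc h17
    have g1 : s'.reg 1 = m := by rw [hf.reg 1 rfl]; simpa using hs.reg_one
    have g13 : s'.reg 13 = i := by rw [hf.reg 13 rfl]; simpa using h13
    have g16 : s'.reg 16 = j := by rw [hf.reg 16 rfl]; simpa using h16
    have a0 : s'.arr 0 (i * m + k) = (X i k).toNat := by
      rw [hf.arr 0 rfl]; simpa using hs.input i hi k hk
    have a0' : s'.arr 0 (j * m + k) = (X j k).toNat := by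
      rw [hf.arr 0 rfl]; simpa using hs.input j hj k hk
    have hv : (Exp.add (.var 17) (.sub (.lit 1)
      (.eq (.get 0 (.add (.mul (.var 13) (.var 1)) (.var 9)))
        (.get 0 (.add (.mul (.var 16) (.var 1)) (.var 9)))))).eval s' =
        dist (k + 1) (X i) (X j) := by
      simp only [Exp.eval, g1, g13, g16, hc, a0, a0', h17, dist, Finset.sum_range_succ]
    refine .assign hW (by decide) ?_ ?_
    · rw [hv]
      exact le_lt_width ((dist_le _ _ _).trans (by omega))
    · simp only [hv, State.setReg_reg]
      simp
  · exact fun s' hf hI => hI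

theorem wp_pointProg (hn : n ≤ 2 ^ (m + 1)) (hs : Env n m d X s) {i : ℕ} (hi : i < n)
    (h13 : s.reg 13 = i) (htbl : ∀ k, s.arr 2 k < n) {b c : ℕ}
    (hb : b = bucket m (s.arr 1) (X i)) (hc : c = s.arr 2 b) :
    Wp dec (width m) (8 * m + 13) pointProg (fun s' =>
      (s'.arr 2 = if d / 2 < fixedDist m (s.arr 1) (X i) then s.arr 2
        else Function.update (s.arr 2) b i) ∧
      if dist m (X i) (X c) = d ∧ c ≠ i then s'.reg 18 = i ∧ s'.reg 19 = c
      else s'.reg 18 = s.reg 18 ∧ s'.reg 19 = s.reg 19) s := by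
  have hW := one_le_width m
  have hltn : ∀ {v}, v < n → v < 2 ^ width m := fun hv =>
    (hv.trans_le hn).trans (two_pow_lt_width (by nlinarith))
  refine Wp.steps_mono (.seq (N₁ := 5 * m + 4) (N₂ := 1 + (3 * m + 3 + (3 + 2)))
    ((wp_keyProg hs hi h13).mono ?_)) (by omega)
  rintro s₁ hf₁ ⟨h14, h15⟩
  rw [← hb] at h14
  have hs₁ := hs.frame hf₁
  have t₁ : s₁.arr 2 = s.arr 2 := hf₁.arr 2 rfl
  have i₁ : s₁.reg 13 = i := (hf₁.reg 13 rfl).trans h13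
  have hv : (Exp.get 2 (.var 14)).eval s₁ = c := by simp [Exp.eval, t₁, h14, hc]
  have hcn : c < n := hc ▸ htbl b
  refine .seq (.assign hW (by decide) ?_ ?_)
  · rw [hv]; exact hltn hcn
  rw [hv]
  have hs₁' : Env n m d X (s₁.setReg 16 c) :=
    ⟨by simpa using hs₁.1, by simpa using hs₁.2, by simpa using hs₁.3, by simpa using hs₁.4,
      by simpa using hs₁.5⟩
  refine .seq ((wp_distProg hs₁' hi hcn (by simpa using i₁) (by simp)).mono ?_)
  intro s₂ hf₂ h17
  have hs₂ := hs₁'.frame hf₂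
  have t₂ : s₂.arr 2 = s.arr 2 := (hf₂.arr 2 rfl).trans t₁
  have i₂ : s₂.reg 13 = i := by rw [hf₂.reg 13 rfl]; simpa using i₁
  have c₂ : s₂.reg 16 = c := by rw [hf₂.reg 16 rfl]; simp
  have b₂ : s₂.reg 14 = b := by rw [hf₂.reg 14 rfl]; simpa using h14
  have f₂ : s₂.reg 15 = fixedDist m (s.arr 1) (X i) := by rw [hf₂.reg 15 rfl]; simpa using h15
  have r₂ : s₂.reg 18 = s.reg 18 := by
    rw [hf₂.reg 18 rfl]; simpa using hf₁.reg 18 rfl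
  have r₂' : s₂.reg 19 = s.reg 19 := by
    rw [hf₂.reg 19 rfl]; simpa using hf₁.reg 19 rfl
  have step₃ : Wp dec (width m) 3 (.ite (.mul (.eq (.var 17) (.var 2)) (.sub (.lit 1)
      (.eq (.var 16) (.var 13)))) (.seq (.assign 18 (.var 13)) (.assign 19 (.var 16))) .skip)
      (fun s' => if dist m (X i) (X c) = d ∧ c ≠ i then s'.reg 18 = i ∧ s'.reg 19 = c
      else s'.reg 18 = s.reg 18 ∧ s'.reg 19 = s.reg 19) s₂ := by
    refine .ite (N := 2) hW (by decide) ?_ ?_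
    · intro h
      simp [Exp.eval, h17, hs₂.reg_two, c₂, i₂, Nat.sub_eq_zero_iff_le] at h
      refine .seq (N₁ := 1) (N₂ := 1) (.assign hW (by decide) ?_ (.assign hW (by decide) ?_ ?_))
      · simpa [Exp.eval, i₂] using hltn hi
      · simpa [Exp.eval, c₂] using hltn hcn
      · rw [if_pos h]
        simp [Exp.eval, i₂, c₂]
    · intro h
      simp [Exp.eval, h17, hs₂.reg_two, c₂, i₂, Nat.sub_eq_zero_iff_le] at h
      refine Wp.steps_mono (.skip ?_) (by norm_num)
      rw [if_neg fun hh => by simpa [hh.2] using h hh.1]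
      exact ⟨r₂, r₂'⟩
  refine .seq (step₃.mono ?_)
  intro s₃ hf₃ hres
  have d₃ : s₃.reg 2 = d := (hs₂.frame hf₃).reg_two
  have t₃ : s₃.arr 2 = s.arr 2 := (hf₃.arr 2 rfl).trans t₂
  have i₃ : s₃.reg 13 = i := (hf₃.reg 13 rfl).trans i₂
  have b₃ : s₃.reg 14 = b := (hf₃.reg 14 rfl).trans b₂
  have f₃ : s₃.reg 15 = _ := (hf₃.reg 15 rfl).trans f₂
  refine .ite (N := 1) hW (by decide) ?_ ?_
  · intro h
    simp [Exp.eval, d₃, f₃] at h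
    exact .skip ⟨by rw [if_pos h, t₃], hres⟩
  · intro h
    simp [Exp.eval, d₃, f₃] at h
    refine .store hW (by decide) (by decide) ?_ ⟨?_, ?_⟩
    · simpa [Exp.eval, i₃] using hltn hi
    · rw [if_neg (not_lt.2 h)]
      simp [Exp.eval, i₃, b₃, t₃]
    · simpa using hres

end ClosestPair

/-! ### One pass over the points, one round, and the whole run. -/

namespace ClosestPair

open RAM

variable {m : ℕ} {dec : Option (BinWord m → BinWord m)} {s : State}
variable {n d : ℕ} {X : ℕ → ℕ → Bool}

/-- The partial word `st` leads to the discovery of the pair `y, y'`. -/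
def Good (m d : ℕ) (st : ℕ → ℕ) (y y' : ℕ → Bool) : Prop :=
  fixedDist m st y ≤ d / 2 ∧ bucket m st y = bucket m st y'

theorem bucket_congr {st st' : ℕ → ℕ} (h : ∀ k < m, st k = st' k) (y : ℕ → Bool) :
    bucket m st y = bucket m st' y :=
  bitsVal_congr fun k hk => by rw [h k hk]

theorem fixedDist_congr {st st' : ℕ → ℕ} (h : ∀ k < m, st k = st' k) (y : ℕ → Bool) :
    fixedDist m st y = fixedDist m st' y :=
  Finset.sum_congr rfl fun k hk => by rw [h k (Finset.mem_range.1 hk)]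

/-- This is the triangle inequality through the partial word on the fixed coordinates; on the free
ones equal buckets mean equal bits. -/
theorem dist_le_of_bucket_eq {st : ℕ → ℕ} (hst : ∀ k < m, st k ≤ 2) {y y' : ℕ → Bool}
    (h : bucket m st y = bucket m st y') :
    dist m y y' ≤ fixedDist m st y + fixedDist m st y' := by
  unfold dist fixedDist
  rw [← Finset.sum_add_distrib]
  refine Finset.sum_le_sum fun k hk => ?_
  have hk' := Finset.mem_range.1 hk
  have h1 := bitsVal_inj h k hk'
  have h2 := hst k hk'
  rcases h2.lt_or_eq with h2 | h2
  · have : st k = 0 ∨ st k = 1 := by omega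
    cases y k <;> cases y' k <;> rcases this with h | h <;> simp [h]
  · simp only [h2, decide_true, Bool.and_true] at h1
    simp [h1]

/-- Points number `i < j` are the only ones at distance at most `d`. -/
structure UniquePair (n m d : ℕ) (X : ℕ → ℕ → Bool) (i j : ℕ) : Prop where
  lt : i < j
  lt_n : j < n
  dist_eq : dist m (X i) (X j) = d
  unique : ∀ a < n, ∀ b < n, a ≠ b → dist m (X a) (X b) ≤ d → s(a, b) = s(i, j)

/-- The pair has been found. -/
def Found (i j : ℕ) (s : State) : Prop := s(s.reg 18, s.reg 19) = s(i, j)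

theorem dist_comm (m : ℕ) (y y' : ℕ → Bool) : dist m y y' = dist m y' y := by
  unfold dist
  simp only [eq_comm]

variable {i j : ℕ}

/-- The table is not emptied between rounds. Stale entries are harmless, since a pair is recorded
only after its distance has been checked and uniqueness then identifies it. For a good partial word,
the bucket of point `i` holds `i` from its insertion until `j` is compared. -/
theorem wp_points (hn : n ≤ 2 ^ (m + 1)) (hX : UniquePair n m d X i j) (hs : Env n m d X s)
    (htbl : ∀ k, s.arr 2 k < n) (hst : ∀ k < m, s.arr 1 k ≤ 2) :
    Wp dec (width m) (n * (8 * m + 15) + 2) (forLoop 13 (.var 0) pointProg) (fun s' =>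
      (∀ k, s'.arr 2 k < n) ∧ (Found i j s → Found i j s') ∧
      (Good m d (s.arr 1) (X i) (X j) → Found i j s')) s := by
  have hW := one_le_width m
  have hjn := hX.lt_n
  have hij := hX.lt
  refine Wp.forLoop (N := 8 * m + 13) hW (fun p s' => (∀ k, s'.arr 2 k < n) ∧
    (Found i j s → Found i j s') ∧ (Good m d (s.arr 1) (X i) (X j) →
      (i < p → p ≤ j → s'.arr 2 (bucket m (s.arr 1) (X i)) = i) ∧ (j < p → Found i j s')))
    (by decide) (hn.trans_lt (two_pow_lt_width (by nlinarith))) rfl ?_ ?_ ?_ ?_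
  · exact fun k _ s' hf _ => (hs.frame hf).reg_zero
  · exact ⟨htbl, fun h => by simpa [Found] using h, fun _ => ⟨by omega, by omega⟩⟩
  · rintro p hp s' hf hc ⟨htbl', hfound, hgood⟩
    have hs' := hs.frame hf
    have a1 : s'.arr 1 = s.arr 1 := hf.arr 1 rfl
    refine (wp_pointProg hn hs' hp hc htbl' rfl rfl).mono ?_
    rintro s'' hf' ⟨ht, hres⟩
    rw [a1] at ht hres
    set b := bucket m (s.arr 1) (X p) with hb
    have hpair : ∀ {q : ℕ}, q = s'.arr 2 b → dist m (X p) (X q) = d → q ≠ p →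
        Found i j s'' := by
      intro q hq h1 h2
      rw [← hq, if_pos ⟨h1, h2⟩] at hres
      rw [Found, hres.1, hres.2]
      exact hX.unique p hp q (hq ▸ htbl' b) h2.symm h1.le
    have hkeep : Found i j s' → Found i j s'' := by
      intro h
      by_cases h' : dist m (X p) (X (s'.arr 2 b)) = d ∧ s'.arr 2 b ≠ p
      · exact hpair rfl h'.1 h'.2
      · rw [if_neg h'] at hres
        rwa [Found, hres.1, hres.2]
    refine ⟨?_, ?_, ?_⟩
    · intro k
      simp only [State.setReg_arr, ht]
      split_ifs
      · exact htbl' k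
      · rw [Function.update_apply]
        split_ifs
        · exact hp
        · exact htbl' k
    · intro h
      simpa [Found] using hkeep (hfound h)
    · intro hg
      obtain ⟨h1, h2⟩ := hgood hg
      constructor
      · intro hip hpj
        simp only [State.setReg_arr, ht]
        rcases Nat.lt_succ_iff_lt_or_eq.1 hip with hip | rfl
        · have h3 := h1 hip (by omega)
          split_ifs with h4
          · exact h3
          · rw [Function.update_apply, if_neg, h3]
            intro h5
            -- A point stored over `i` would be within d/2 + d/2 ≤ d of it, hence equal to `j`,
            -- which has not been reached yet.
            have h6 := dist_le_of_bucket_eq hst h5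
            have h7 := hX.unique i (by omega) p hp (by omega) (by have := hg.1; omega)
            simp only [Sym2.eq_iff] at h7
            omega
        · rw [if_neg (not_lt.2 hg.1), hb, Function.update_self]
      · intro hjp
        have : Found i j s'' := by
          rcases Nat.lt_succ_iff_lt_or_eq.1 hjp with hjp | rfl
          · exact hkeep (h2 hjp)
          -- Only the bucket of `j` matters here: the comparison precedes the storage test, so `j`
          -- need not pass it.
          · have h3 := h1 hij le_rfl
            rw [hg.2, ← hb] at h3
            exact hpair h3.symm (by rw [dist_comm]; exact hX.dist_eq) (by omega)
        simpa [Found] using this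
  · rintro s' hf ⟨h1, h2, h3⟩
    exact ⟨h1, h2, fun hg => (h3 hg).2 hjn⟩

/-- The partial word that is drawn from the tape `τ`. -/
def partialWord (m d : ℕ) (τ : ℕ → Bool) (k : ℕ) : ℕ := cell (threshold m d) (drawn m τ k)

theorem wp_roundProg (hn : n ≤ 2 ^ (m + 1)) (hX : UniquePair n m d X i j) (hs : Env n m d X s)
    (htbl : ∀ k, s.arr 2 k < n) {τ : ℕ → Bool} (hτ : s.tape = τ) :
    Wp dec (width m) (m * (4 * m + 14) + 2 + (n * (8 * m + 15) + 2)) roundProg (fun s' =>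
      (∀ k, s'.arr 2 k < n) ∧ (Found i j s → Found i j s') ∧
      (Good m d (partialWord m d τ) (X i) (X j) → Found i j s') ∧
      s'.tape = fun l => τ (m * (m + 2) + l)) s := by
  refine .seq ((wp_drawProg hs.reg_one hs.reg_four hτ).mono ?_)
  rintro s' hf ⟨hst, ht⟩
  refine (wp_points hn hX (hs.frame hf) ?_ ?_).mono ?_
  · rw [hf.arr 2 rfl]; exact htbl
  · exact fun k hk => (hst k hk).le.trans (cell_le _ _)
  · rintro s'' hf' ⟨h1, h2, h3⟩
    refine ⟨h1, fun h => h2 ?_, fun h => h3 ?_, (hf'.tape rfl).trans ht⟩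
    · rw [Found, hf.reg 18 rfl, hf.reg 19 rfl]; exact h
    · have hst' : ∀ k < m, s'.arr 1 k = partialWord m d τ k := hst
      rwa [Good, fixedDist_congr hst', bucket_congr hst', bucket_congr hst']

/-- The number of elementary steps of the algorithm. -/
def steps (n m d : ℕ) : ℕ :=
  (3 * (m + 2) + 3) + (3 + ((5 * m + 4) + (1 +
    ((reps m d * ((m * (4 * m + 14) + 2 + (n * (8 * m + 15) + 2)) + 2) + 2) + (1 + 1)))))

/-- Round `ρ` reads the m(m+2) tape bits from position ρ · m(m+2) on, so success becomes a condition
on disjoint blocks of the tape, free of any reference to the machine. -/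
theorem wp_mainProg (hm : 0 < m) (hd : d ≤ m) (hn : n ≤ 2 ^ (m + 1))
    (hX : UniquePair n m d X i j) (h0 : s.reg 0 = n) (h1 : s.reg 1 = m) (h2 : s.reg 2 = d)
    (hx : ∀ i < n, ∀ k < m, s.arr 0 (i * m + k) = (X i k).toNat) (htbl : ∀ k, s.arr 2 k = 0)
    {ω : ℕ → Bool} (hω : s.tape = ω) :
    Wp dec (width m) (steps n m d) mainProg (fun s' =>
      (∃ ρ < reps m d, Good m d (partialWord m d fun l => ω (ρ * (m * (m + 2)) + l)) (X i) (X j)) →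
        s(s'.reg 0, s'.reg 1) = s(i, j)) s := by
  have hW := one_le_width m
  have hn0 : 0 < n := by have := hX.lt; have := hX.lt_n; omega
  refine .seq ((wp_powProg h1).mono fun s₁ f₁ h3 => ?_)
  refine .seq ((wp_thresholdProg hm hd ((f₁.reg 1 rfl).trans h1) ((f₁.reg 2 rfl).trans h2)
    h3).mono fun s₂ f₂ h4 => ?_)
  have e₂ : Env n m d X s₂ := by
    refine ⟨?_, ?_, ?_, h4, ?_⟩
    · rw [f₂.reg 0 rfl, f₁.reg 0 rfl, h0]
    · rw [f₂.reg 1 rfl, f₁.reg 1 rfl, h1]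
    · rw [f₂.reg 2 rfl, f₁.reg 2 rfl, h2]
    · rw [f₂.arr 0 rfl, f₁.arr 0 rfl]; exact hx
  refine .seq ((wp_ratioProg e₂.reg_one e₂.reg_two ((f₂.reg 3 rfl).trans h3)
    h4).mono fun s₃ f₃ h56 => ?_)
  have e₃ := e₂.frame f₃
  refine .seq ((wp_repsProg e₃.reg_one h56.1 h56.2).mono fun s₄ f₄ h7 => ?_)
  have e₄ := e₃.frame f₄
  have t₄ : ∀ k, s₄.arr 2 k = 0 := by
    rw [f₄.arr 2 rfl, f₃.arr 2 rfl, f₂.arr 2 rfl, f₁.arr 2 rfl]; exact htbl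
  have ω₄ : s₄.tape = ω := by
    rw [f₄.tape rfl, f₃.tape rfl, f₂.tape rfl, f₁.tape rfl]; exact hω
  have main : Wp dec (width m)
      (reps m d * ((m * (4 * m + 14) + 2 + (n * (8 * m + 15) + 2)) + 2) + 2)
      (forLoop 8 (.var 7) roundProg) (fun s' =>
      (∃ ρ < reps m d, Good m d (partialWord m d fun l => ω (ρ * (m * (m + 2)) + l)) (X i) (X j)) →
        Found i j s') s₄ := by
    refine Wp.forLoop hW (fun q s' => (∀ k, s'.arr 2 k < n) ∧
      (s'.tape = fun l => ω (q * (m * (m + 2)) + l)) ∧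
      ((∃ ρ < q, Good m d (partialWord m d fun l => ω (ρ * (m * (m + 2)) + l)) (X i) (X j)) →
        Found i j s')) (by decide) (reps_lt m d) rfl ?_ ?_ ?_ ?_
    · exact fun k _ s' hf _ => (hf.reg 7 rfl).trans h7
    · refine ⟨fun k => ?_, ?_, ?_⟩
      · rw [State.setReg_arr, t₄]; exact hn0
      · simp [ω₄]
      · rintro ⟨ρ, h, -⟩
        omega
    · rintro q hq s' hf hc ⟨htbl', ht, hfound⟩
      refine (wp_roundProg hn hX (e₄.frame hf) htbl' ht).mono ?_
      rintro s'' hf' ⟨g1, g2, g3, g4⟩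
      refine ⟨g1, ?_, ?_⟩
      · rw [State.setReg_tape, g4]
        funext l
        congr 1
        ring
      · rintro ⟨ρ, hρ, hg⟩
        have : Found i j s'' := by
          rcases Nat.lt_succ_iff_lt_or_eq.1 hρ with hρ | rfl
          · exact g2 (hfound ⟨ρ, hρ, hg⟩)
          · exact g3 hg
        simpa [Found] using this
    · exact fun s' _ h => h.2.2
  -- If no pair was found, nothing is known about registers 18 and 19 except that they are bounded,
  -- which the final copies need.
  refine .seq (main.bounded.mono fun s₅ f₅ h => ?_)
  refine .seq (.assign hW (by decide) (h.1.1 18) (.assign hW (by decide) ?_ ?_))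
  · simpa [Exp.eval] using h.1.1 19
  · intro hg
    simpa [Exp.eval, Found] using h.2 hg

end ClosestPair

namespace ClosestPair

open RAM

/-! ### The number of good partial words -/

/-- The number with the binary digits `b`. -/
def digitsVal {L : ℕ} (b : Fin L → Bool) : ℕ :=
  bitsVal (fun l => if h : l < L then b ⟨l, h⟩ else false) L

theorem digitsVal_lt {L : ℕ} (b : Fin L → Bool) : digitsVal b < 2 ^ L := bitsVal_lt _ _

theorem digitsVal_injective (L : ℕ) : Function.Injective (digitsVal (L := L)) := by
  intro b b' h
  funext l
  simpa using bitsVal_inj h l l.2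

/-- Uniform bits make a uniform number, since `digitsVal` is a bijection onto the numbers below 2^L.
-/
theorem card_digitsVal (L : ℕ) (p : ℕ → Prop) [DecidablePred p] :
    (Finset.univ.filter fun b : Fin L → Bool => p (digitsVal b)).card =
      ((Finset.range (2 ^ L)).filter p).card := by
  have himg : Finset.univ.image (digitsVal (L := L)) = Finset.range (2 ^ L) := by
    refine Finset.eq_of_subset_of_card_le ?_ ?_
    · intro v hv
      obtain ⟨b, -, rfl⟩ := Finset.mem_image.1 hv
      exact Finset.mem_range.2 (digitsVal_lt b)
    · rw [Finset.card_image_of_injective _ (digitsVal_injective L)]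
      simp
  rw [← himg, Finset.filter_image, Finset.card_image_of_injective _ (digitsVal_injective L)]

theorem cell_eq_zero {a u : ℕ} : cell a u = 0 ↔ u < a := by
  unfold cell
  split_ifs <;> simp <;> omega

theorem cell_eq_one {a u : ℕ} : cell a u = 1 ↔ a ≤ u ∧ u < 2 * a := by
  unfold cell
  split_ifs <;> simp <;> omega

theorem card_cell_eq {L a : ℕ} (ha : 2 * a ≤ 2 ^ L) (c : Bool) :
    (Finset.univ.filter fun b : Fin L → Bool => cell a (digitsVal b) = c.toNat).card = a := by
  rw [card_digitsVal L fun u => cell a u = c.toNat]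
  cases c
  · rw [show (Finset.range (2 ^ L)).filter (fun u => cell a u = Bool.toNat false) =
      Finset.Ico 0 a by
        ext u
        simp only [Finset.mem_filter, Finset.mem_range, Finset.mem_Ico, Bool.toNat_false,
          cell_eq_zero]
        omega]
    simp
  · rw [show (Finset.range (2 ^ L)).filter (fun u => cell a u = Bool.toNat true) =
      Finset.Ico a (2 * a) by
        ext u
        simp only [Finset.mem_filter, Finset.mem_range, Finset.mem_Ico, Bool.toNat_true,
          cell_eq_one]
        omega]
    simp
    omega

theorem card_cell_ne {L a : ℕ} (ha : 2 * a ≤ 2 ^ L) (c : Bool) :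
    (Finset.univ.filter fun b : Fin L → Bool => cell a (digitsVal b) ≠ (!c).toNat).card =
      2 ^ L - a := by
  have h := Finset.card_filter_add_card_filter_not (s := Finset.univ)
    (fun b : Fin L → Bool => cell a (digitsVal b) = (!c).toNat)
  rw [card_cell_eq ha] at h
  simp only [Finset.card_univ, Fintype.card_pi, Fintype.card_bool, Finset.prod_const,
    Fintype.card_fin] at h
  simp only [ne_eq]
  omega

/-- The partial word that is drawn from a block of random bits. -/
def blockWord {m L : ℕ} (a : ℕ) (β : Fin m → Fin L → Bool) (k : ℕ) : ℕ :=
  if h : k < m then cell a (digitsVal (β ⟨k, h⟩)) else 2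

open Classical in
/-- The blocks of random bits that lead to the discovery of the pair `y, y'`. -/
noncomputable def goodBlocks (m L a d : ℕ) (y y' : ℕ → Bool) : Finset (Fin m → Fin L → Bool) :=
  Finset.univ.filter fun β => Good m d (blockWord a β) y y'

/-- The coordinates in which `y` and `y'` differ. -/
def diffSet (m : ℕ) (y y' : ℕ → Bool) : Finset (Fin m) := Finset.univ.filter fun k => y k ≠ y' k

theorem card_diffSet (m : ℕ) (y y' : ℕ → Bool) : (diffSet m y y').card = dist m y y' := by
  rw [dist, Finset.sum_range, diffSet, Finset.card_filter]
  refine Finset.sum_congr rfl fun k _ => ?_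
  cases y k <;> cases y' k <;> simp

/-- The blocks for which the partial word differs from `y` exactly in the fixed coordinates `T`. -/
def box {m : ℕ} (L a : ℕ) (y y' : ℕ → Bool) (T : Finset (Fin m)) :
    Finset (Fin m → Fin L → Bool) :=
  Fintype.piFinset fun k =>
    if k ∈ diffSet m y y' then
      Finset.univ.filter fun b => cell a (digitsVal b) = (if k ∈ T then !y k else y k).toNat
    else Finset.univ.filter fun b => cell a (digitsVal b) ≠ (!y k).toNat

/-- A differing coordinate has its entry prescribed (`a` outcomes); an agreeing one only avoids the
wrong value (2^L - a outcomes). -/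
theorem card_box {m L a : ℕ} (ha : 2 * a ≤ 2 ^ L) (y y' : ℕ → Bool) (T : Finset (Fin m)) :
    (box L a y y' T).card = a ^ dist m y y' * (2 ^ L - a) ^ (m - dist m y y') := by
  have h : ∀ k : Fin m, (if k ∈ diffSet m y y' then
      Finset.univ.filter fun b : Fin L → Bool =>
        cell a (digitsVal b) = (if k ∈ T then !y k else y k).toNat
    else Finset.univ.filter fun b => cell a (digitsVal b) ≠ (!y k).toNat).card =
      if k ∈ diffSet m y y' then a else 2 ^ L - a := by
    intro k
    split_ifs
    · exact card_cell_eq ha _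
    · exact card_cell_eq ha _
    · exact card_cell_ne ha _
  rw [box, Fintype.card_piFinset, Finset.prod_congr rfl fun k _ => h k, Finset.prod_ite,
    Finset.prod_const, Finset.prod_const, Finset.filter_not, Finset.filter_mem_eq_inter,
    Finset.univ_inter, Finset.card_sdiff_of_subset (Finset.subset_univ _), card_diffSet]
  simp

/-- The set `T` can be read off from any block in its box, so boxes of different sets are disjoint.
-/
theorem box_recover {m L a : ℕ} {y y' : ℕ → Bool} {T : Finset (Fin m)}
    (hT : T ⊆ diffSet m y y') {β : Fin m → Fin L → Bool} (hβ : β ∈ box L a y y' T) :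
    T = (diffSet m y y').filter fun k => cell a (digitsVal (β k)) ≠ (y k).toNat := by
  ext k
  have h := Fintype.mem_piFinset.1 hβ k
  by_cases hk : k ∈ diffSet m y y'
  · simp only [hk, if_true, Finset.mem_filter, Finset.mem_univ, true_and] at h ⊢
    rw [h]
    by_cases hkT : k ∈ T <;> cases y k <;> simp [hkT]
  · simp only [Finset.mem_filter, hk, false_and, iff_false]
    exact fun h => hk (hT h)

/-- Fixed entries disagree with `y` only inside `T`, and free entries occur only where `y` and `y'`
agree, so the two buckets coincide. -/
theorem box_subset_goodBlocks {m L a d : ℕ} {y y' : ℕ → Bool} {T : Finset (Fin m)}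
    (hd : T.card = d / 2) :
    box L a y y' T ⊆ goodBlocks m L a d y y' := by
  classical
  intro β hβ
  simp only [goodBlocks, Finset.mem_filter, Finset.mem_univ, true_and]
  have hw : ∀ k : Fin m, blockWord a β k = cell a (digitsVal (β k)) := fun k => by
    simp [blockWord]
  have h := fun k => Fintype.mem_piFinset.1 hβ k
  constructor
  · rw [← hd, fixedDist, Finset.sum_range, Finset.card_eq_sum_ones,
      ← Finset.sum_filter_add_sum_filter_not _ (· ∈ T), Finset.filter_mem_eq_inter, Finset.univ_inter]
    refine (add_le_add (Finset.sum_le_sum (g := fun _ => 1) fun k hk => ?_)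
      (Finset.sum_nonpos fun k hk => ?_)).trans_eq (add_zero _)
    · split_ifs <;> omega
    · have hkT : k ∉ T := (Finset.mem_filter.1 hk).2
      have hc := cell_le a (digitsVal (β k))
      have := h k
      rw [hw k]
      by_cases hkd : k ∈ diffSet m y y'
      · simp only [hkd, hkT, if_true, if_false, Finset.mem_filter, Finset.mem_univ,
          true_and] at this
        simp [this]
        split_ifs <;> omega
      · simp only [hkd, if_false, Finset.mem_filter, Finset.mem_univ, true_and] at this
        cases hy : y k <;> simp [hy] at this ⊢ <;> split_ifs <;> omega
  · refine bitsVal_congr fun k hk => ?_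
    have := h ⟨k, hk⟩
    have hw' := hw ⟨k, hk⟩
    simp only at hw'
    by_cases hkd : (⟨k, hk⟩ : Fin m) ∈ diffSet m y y'
    · simp only [hkd, if_true, Finset.mem_filter, Finset.mem_univ, true_and] at this
      rw [this] at hw'
      have h2 : blockWord a β k ≠ 2 := by
        rw [hw']
        exact ((Bool.toNat_lt _).ne)
      simp [h2]
    · simp only [diffSet, Finset.mem_filter, Finset.mem_univ, true_and, not_not] at hkd
      rw [hkd]

/-- The middle one is the largest of d + 1 binomial coefficients with sum 2^d. -/
theorem two_pow_le_choose (d : ℕ) : 2 ^ d ≤ (d + 1) * d.choose (d / 2) := by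
  rw [← Nat.sum_range_choose]
  refine (Finset.sum_le_card_nsmul _ _ _ fun k _ => Nat.choose_le_middle k d).trans ?_
  simp

theorem card_goodBlocks {m L a d : ℕ} (ha : 2 * a ≤ 2 ^ L) {y y' : ℕ → Bool}
    (hd : dist m y y' = d) :
    (2 * a) ^ d * (2 ^ L - a) ^ (m - d) ≤ (d + 1) * (goodBlocks m L a d y y').card := by
  classical
  have hsub : ((diffSet m y y').powersetCard (d / 2)).biUnion (box L a y y') ⊆
      goodBlocks m L a d y y' := by
    refine Finset.biUnion_subset.2 fun T hT => ?_
    rw [Finset.mem_powersetCard] at hT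
    exact box_subset_goodBlocks hT.2
  have hcard := Finset.card_le_card hsub
  rw [Finset.card_biUnion, Finset.sum_congr rfl fun T _ => card_box ha y y' T, Finset.sum_const,
    Finset.card_powersetCard, card_diffSet, hd, smul_eq_mul] at hcard
  · calc (2 * a) ^ d * (2 ^ L - a) ^ (m - d) = 2 ^ d * (a ^ d * (2 ^ L - a) ^ (m - d)) := by
          rw [mul_pow]; ring
      _ ≤ (d + 1) * d.choose (d / 2) * (a ^ d * (2 ^ L - a) ^ (m - d)) := by
          gcongr; exact two_pow_le_choose d
      _ ≤ _ := by rw [mul_assoc]; gcongr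
  · intro T hT T' hT' hne
    refine Finset.disjoint_left.2 fun β h h' => hne ?_
    rw [box_recover (Finset.mem_powersetCard.1 hT).1 h,
      box_recover (Finset.mem_powersetCard.1 hT').1 h']

theorem denom_eq {m d : ℕ} (hd : d ≤ m) :
    denom m d m = (2 * threshold m d) ^ d * (2 ^ (m + 2) - threshold m d) ^ (m - d) := by
  obtain ⟨k, rfl⟩ := Nat.exists_eq_add_of_le hd
  rw [denom, Finset.prod_range_add, Finset.prod_congr rfl fun j hj =>
    if_pos (Finset.mem_range.1 hj)]
  simp

theorem blockWord_eq {m d : ℕ} (τ : ℕ → Bool) {k : ℕ} (hk : k < m) :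
    partialWord m d τ k = blockWord (threshold m d)
      (fun (k : Fin m) (l : Fin (m + 2)) => τ (k * (m + 2) + l)) k := by
  rw [partialWord, blockWord, dif_pos hk, drawn, digitsVal]
  congr 1
  exact bitsVal_congr fun l hl => by simp [hl]

end ClosestPair

namespace ClosestPair

open RAM MeasureTheory

/-! ### The success probability -/

theorem fairBits_cylinder {ι : Type*} [Fintype ι] {e : ι → ℕ} (he : Function.Injective e)
    (b : ι → Bool) : fairBits.real {ω | ∀ t, ω (e t) = b t} = (1 / 2) ^ Fintype.card ι := by
  classical
  have hset : {ω : ℕ → Bool | ∀ t, ω (e t) = b t} =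
      Set.pi (Finset.univ.image e : Finset ℕ)
        (fun k => {Function.extend e b (fun _ => false) k}) := by
    ext ω
    simp [Set.mem_pi, he.extend_apply]
  rw [Measure.real, hset, fairBits, Measure.infinitePi_pi _ (fun _ _ => MeasurableSet.singleton _),
    Finset.prod_image fun _ _ _ _ h => he h]
  simp

instance : IsProbabilityMeasure fairBits := by
  unfold fairBits
  infer_instance

theorem fairBits_mem_finset {ι : Type*} [Fintype ι] {e : ι → ℕ}
    (he : Function.Injective e) (B : Finset (ι → Bool)) :
    fairBits.real {ω | (fun t => ω (e t)) ∈ B} = B.card * (1 / 2) ^ Fintype.card ι := by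
  have hset : {ω : ℕ → Bool | (fun t => ω (e t)) ∈ B} =
      ⋃ b ∈ B, {ω : ℕ → Bool | ∀ t, ω (e t) = b t} := by
    ext ω
    simp only [Set.mem_ofPred_eq, Set.mem_iUnion, exists_prop]
    constructor
    · exact fun h => ⟨_, h, fun _ => rfl⟩
    · rintro ⟨b, hb, h⟩
      rwa [show (fun t => ω (e t)) = b from funext h]
  rw [hset, measureReal_biUnion_finset, Finset.sum_congr rfl fun b _ => fairBits_cylinder he b,
    Finset.sum_const, nsmul_eq_mul]
  · intro b _ b' _ hne
    refine Set.disjoint_left.2 fun ω h h' => hne ?_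
    funext t
    exact (h t).symm.trans (h' t)
  · intro b _
    have : {ω : ℕ → Bool | ∀ t, ω (e t) = b t} = ⋂ t, {ω | ω (e t) = b t} := by ext; simp
    rw [this]
    exact MeasurableSet.iInter fun t =>
      measurableSet_eq_fun (measurable_pi_apply _) measurable_const

/-- The position on the tape of a random bit. -/
def tapePos (R m L : ℕ) (t : Fin R × Fin m × Fin L) : ℕ :=
  t.1 * (m * L) + (t.2.1 * L + t.2.2)

theorem tapePos_injective (R m L : ℕ) : Function.Injective (tapePos R m L) := by
  rintro ⟨ρ, k, l⟩ ⟨ρ', k', l'⟩ h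
  have key : ∀ {q a b a' b' : ℕ}, b < q → b' < q → a * q + b = a' * q + b' → a = a' ∧ b = b' := by
    intro q a b a' b' hb hb' h
    have hq : 0 < q := by omega
    have h1 := congrArg (· / q) h
    have h2 := congrArg (· % q) h
    simp only [Nat.mul_add_mod_self_right, Nat.mod_eq_of_lt hb, Nat.mod_eq_of_lt hb'] at h2
    simp only [mul_comm _ q, Nat.mul_add_div hq, Nat.div_eq_of_lt hb, Nat.div_eq_of_lt hb',
      add_zero] at h1
    exact ⟨h1, h2⟩
  have hlt : ∀ (k : Fin m) (l : Fin L), (k : ℕ) * L + l < m * L := fun k l => by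
    have := k.2
    have := l.2
    calc (k : ℕ) * L + l < k * L + L := by omega
      _ = (k + 1) * L := by ring
      _ ≤ m * L := Nat.mul_le_mul_right _ k.2
  obtain ⟨h1, h2⟩ := key (hlt k l) (hlt k' l') h
  obtain ⟨h3, h4⟩ := key l.2 l'.2 h2
  exact Prod.ext (Fin.ext h1) (Prod.ext (Fin.ext h3) (Fin.ext h4))

/-- Independence of the rounds, obtained by counting: they read disjoint tape positions, and the
favourable assignments form a product set. -/
theorem fairBits_blocks (R m L : ℕ) (B : Finset (Fin m → Fin L → Bool)) :
    fairBits.real {ω | ∀ ρ : Fin R, (fun k l => ω (tapePos R m L (ρ, k, l))) ∈ B} =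
      (B.card / (2 ^ L) ^ m) ^ R := by
  classical
  let c : (Fin R × Fin m × Fin L → Bool) ≃ (Fin R → Fin m → Fin L → Bool) :=
    (Equiv.curry _ _ _).trans (Equiv.arrowCongr (Equiv.refl _) (Equiv.curry _ _ _))
  have h := fairBits_mem_finset (tapePos_injective R m L)
    ((Fintype.piFinset fun _ : Fin R => B).map c.symm.toEmbedding)
  have hset : {ω : ℕ → Bool | (fun t => ω (tapePos R m L t)) ∈
      (Fintype.piFinset fun _ : Fin R => B).map c.symm.toEmbedding} =
      {ω | ∀ ρ : Fin R, (fun k l => ω (tapePos R m L (ρ, k, l))) ∈ B} := by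
    ext ω
    simp only [Finset.mem_map_equiv, Equiv.symm_symm, Fintype.mem_piFinset, Set.mem_ofPred_eq]
    rfl
  rw [hset] at h
  rw [h, Finset.card_map, Fintype.card_piFinset]
  simp only [Finset.prod_const, Finset.card_univ, Fintype.card_fin, Fintype.card_prod,
    Nat.cast_pow, one_div]
  rw [div_pow, ← pow_mul, ← pow_mul, inv_pow, div_eq_mul_inv,
    show R * (m * L) = L * (m * R) by ring]

theorem card_goodBlocks_compl {m L a d : ℕ} (y y' : ℕ → Bool) :
    ((goodBlocks m L a d y y')ᶜ.card : ℝ) = (2 ^ L) ^ m - (goodBlocks m L a d y y').card := by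
  classical
  rw [Finset.card_compl, Nat.cast_sub (Finset.card_le_univ _)]
  simp

theorem threshold_pos {m d : ℕ} (hm : 0 < m) (hd : 0 < d) : 0 < threshold m d := by
  refine lt_min (Nat.div_pos ?_ hm) (by positivity)
  have : 1 * 1 ≤ 2 ^ (m + 2) * d := Nat.mul_le_mul Nat.one_le_two_pow hd
  omega

/-- For d = 0 the threshold vanishes, but then the product contains no factor `2 * threshold m d`.
-/
theorem denom_pos {m d : ℕ} (hm : 0 < m) : 0 < denom m d m := by
  refine Finset.prod_pos fun j _ => ?_
  have h1 : threshold m d ≤ 2 ^ (m + 1) := min_le_right _ _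
  have h2 : 2 ^ (m + 1) < 2 ^ (m + 2) := Nat.pow_lt_pow_right (by norm_num) (by omega)
  split_ifs with h
  · have := threshold_pos hm (d := d) (by omega)
    omega
  · omega

theorem failure_le {m n d : ℕ} (hm : 0 < m) (hd : d ≤ m) (hn0 : 0 < n) (hn : n ≤ 2 ^ (m + 1))
    {y y' : ℕ → Bool} (hy : dist m y y' = d) :
    fairBits.real {ω | ¬ ∃ ρ < reps m d,
      Good m d (partialWord m d fun l => ω (ρ * (m * (m + 2)) + l)) y y'} ≤ 1 / (n : ℝ) ^ 2 := by
  classical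
  set G := goodBlocks m (m + 2) (threshold m d) d y y' with hG
  have hset : {ω : ℕ → Bool | ¬ ∃ ρ < reps m d,
      Good m d (partialWord m d fun l => ω (ρ * (m * (m + 2)) + l)) y y'} =
      {ω | ∀ ρ : Fin (reps m d), (fun k l => ω (tapePos (reps m d) m (m + 2) (ρ, k, l))) ∈ Gᶜ} := by
    ext ω
    have hgood : ∀ ρ : ℕ, Good m d (partialWord m d fun l => ω (ρ * (m * (m + 2)) + l)) y y' ↔
        Good m d (blockWord (threshold m d) fun (k : Fin m) (l : Fin (m + 2)) =>
          ω (ρ * (m * (m + 2)) + (k * (m + 2) + l))) y y' := by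
      intro ρ
      have h : ∀ k < m, partialWord m d (fun l => ω (ρ * (m * (m + 2)) + l)) k = _ :=
        fun k hk => blockWord_eq _ hk
      rw [Good, Good, fixedDist_congr h, bucket_congr h, bucket_congr h]
    simp only [Set.mem_ofPred_eq, Finset.mem_compl, hG, goodBlocks, Finset.mem_filter,
      Finset.mem_univ, true_and, not_exists, not_and, hgood, tapePos]
    exact ⟨fun h ρ => h ρ ρ.2, fun h ρ hρ => h ⟨ρ, hρ⟩⟩
  rw [hset, fairBits_blocks, card_goodBlocks_compl, ← hG]
  set T : ℝ := (2 ^ (m + 2)) ^ m with hT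
  have hTpos : 0 < T := by positivity
  have hden : (0 : ℝ) < denom m d m := by exact_mod_cast denom_pos hm
  have hcard : (denom m d m : ℝ) ≤ (m + 1) * G.card := by
    have h := card_goodBlocks (threshold_le m d) hy
    rw [← denom_eq hd] at h
    have h' : (d + 1) * G.card ≤ (m + 1) * G.card := by gcongr
    exact_mod_cast h.trans h'
  have hreps : 2 * ((m + 1) * (m + 1)) * T / denom m d m ≤ reps m d := by
    have := Nat.lt_div_mul_add (a := 2 * ((m + 1) * (m + 1)) * (2 ^ (m + 2)) ^ m)
      (denom_pos (d := d) hm)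
    rw [div_le_iff₀ hden]
    have h2 : 2 * ((m + 1) * (m + 1)) * (2 ^ (m + 2)) ^ m ≤ reps m d * denom m d m := by
      refine this.le.trans_eq ?_
      unfold reps
      ring
    rw [hT]
    exact_mod_cast h2
  have hGT : (G.card : ℝ) ≤ T := by
    have := Finset.card_le_univ G
    simp only [Fintype.card_pi, Fintype.card_bool, Finset.prod_const, Finset.card_univ,
      Fintype.card_fin] at this
    rw [hT]
    exact_mod_cast this
  -- Of the two factors m + 1 in the number of rounds, one pays for the loss d + 1 at the middle
  -- binomial coefficient, the other supplies the exponent that beats n ≤ 2^(m+1).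
  have hgR : 2 * ((m : ℝ) + 1) ≤ G.card / T * reps m d := by
    have hm1 : (0 : ℝ) < m + 1 := by positivity
    calc 2 * ((m : ℝ) + 1)
        = denom m d m / (m + 1) / T * (2 * ((m + 1) * (m + 1)) * T / denom m d m) := by
          field_simp
      _ ≤ G.card / T * reps m d := by
          gcongr
          rw [div_le_iff₀ hm1]
          linarith
  have h1 : (T - G.card) / T = 1 - G.card / T := by field_simp
  rw [h1]
  have hn0' : (0 : ℝ) < n := by exact_mod_cast hn0
  have hn' : (n : ℝ) ≤ 2 ^ (m + 1) := by exact_mod_cast hn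
  calc (1 - G.card / T) ^ reps m d ≤ Real.exp (-(G.card / T)) ^ reps m d := by
        gcongr
        · rw [sub_nonneg, div_le_one hTpos]; exact hGT
        · exact Real.one_sub_le_exp_neg _
    _ = Real.exp (-(G.card / T * reps m d)) := by
        rw [← Real.exp_nat_mul]; congr 1; ring
    _ ≤ Real.exp (-(2 * ((m : ℝ) + 1))) := by
        gcongr
    _ = (Real.exp 1 ^ (m + 1))⁻¹ ^ 2 := by
        rw [← Real.exp_nat_mul, ← Real.exp_neg, ← Real.exp_nat_mul]
        congr 1
        push_cast
        ring
    _ ≤ ((n : ℝ)⁻¹) ^ 2 := by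
        have h2 : (2 : ℝ) ≤ Real.exp 1 := by
          have := Real.add_one_le_exp (1 : ℝ); linarith
        gcongr
        exact hn'.trans (by gcongr)
    _ = 1 / (n : ℝ) ^ 2 := by rw [inv_pow, one_div]

end ClosestPair

namespace ClosestPair

open RAM

/-! ### Entropy estimates -/

theorem entropy2_nonneg {p : ℝ} (h0 : 0 ≤ p) (h1 : p ≤ 1) : 0 ≤ entropy2 p :=
  div_nonneg (Real.binEntropy_nonneg h0 h1) (Real.log_nonneg (by norm_num))

theorem entropy2_le_one (p : ℝ) : entropy2 p ≤ 1 := by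
  have h := Real.log_pos (by norm_num : (1 : ℝ) < 2)
  rw [entropy2, div_le_one h]
  exact Real.binEntropy_le_log_two

theorem entropy2Inv_spec {y : ℝ} (h0 : 0 ≤ y) (h1 : y ≤ 1) :
    entropy2Inv y ∈ Set.Icc (0 : ℝ) (1 / 2) ∧ entropy2 (entropy2Inv y) = y := by
  have hlog := Real.log_pos (by norm_num : (1 : ℝ) < 2)
  have hcont : ContinuousOn entropy2 (Set.Icc (0 : ℝ) (1 / 2)) :=
    (Real.binEntropy_continuous.div_const _).continuousOn
  have hmem : y ∈ Set.Icc (entropy2 0) (entropy2 (1 / 2)) := by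
    have e : entropy2 (1 / 2) = 1 := by
      rw [entropy2, one_div, Real.binEntropy_two_inv, div_self hlog.ne']
    rw [e]
    simpa [entropy2] using ⟨h0, h1⟩
  have h : ∃ a ∈ Set.Icc (0 : ℝ) (1 / 2), entropy2 a = y :=
    intermediate_value_Icc (by norm_num) hcont hmem
  exact ⟨Function.invFunOn_mem h, Function.invFunOn_eq h⟩

theorem zyablovRate_le {δ : ℝ} (h0 : 0 ≤ δ) (h1 : δ ≤ 1) : zyablovRate δ ≤ 1 - entropy2 δ := by
  have hH := entropy2_le_one δ
  have hH' := entropy2_nonneg h0 h1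
  refine Real.sSup_le ?_ (by linarith)
  rintro _ ⟨κ, ⟨hκ0, hκ1⟩, rfl⟩
  have hinv := (entropy2Inv_spec (y := 1 - κ) (by linarith) (by linarith)).1.1
  have : 0 ≤ δ / entropy2Inv (1 - κ) := by positivity
  simp only
  nlinarith

theorem zyablovRate_nonpos {δ : ℝ} (h0 : 1 / 2 ≤ δ) (h1 : δ ≤ 1) : zyablovRate δ ≤ 0 := by
  refine Real.sSup_nonpos ?_
  rintro _ ⟨κ, ⟨hκ0, hκ1⟩, rfl⟩
  have hH' := entropy2_nonneg (by linarith) h1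
  obtain ⟨⟨hi0, hi1⟩, hi⟩ := entropy2Inv_spec (y := 1 - κ) (by linarith) (by linarith)
  -- Positivity is essential: a zero denominator would make the quotient 0 by convention.
  have hpos : 0 < entropy2Inv (1 - κ) := by
    refine lt_of_le_of_ne hi0 fun h => ?_
    rw [← h] at hi
    simp [entropy2] at hi
    linarith
  have : 1 ≤ δ / entropy2Inv (1 - κ) := by
    rw [le_div_iff₀ hpos]; linarith
  simp only
  nlinarith

/-- The case k = 0 covers d = 0 and d = m, where 0 log 0 = 0 corresponds to 0^0 = 1. -/
theorem exp_mul_log {x : ℝ} {k : ℕ} (h : k ≠ 0 → 0 < x) : Real.exp (k * Real.log x) = x ^ k := by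
  rcases eq_or_ne k 0 with rfl | hk
  · simp
  · rw [Real.exp_nat_mul, Real.exp_log (h hk)]

theorem two_rpow_entropy2 {m d : ℕ} (hm : 0 < m) (hd : d ≤ m) :
    (2 : ℝ) ^ (entropy2 ((d : ℝ) / m) * m) *
      (((d : ℝ) / m) ^ d * (1 - (d : ℝ) / m) ^ (m - d)) = 1 := by
  have hm' : (0 : ℝ) < m := by exact_mod_cast hm
  have hlog := Real.log_pos (by norm_num : (1 : ℝ) < 2)
  rw [Real.rpow_def_of_pos (by norm_num),
    ← exp_mul_log (x := (d : ℝ) / m) (k := d) fun h => div_pos (by positivity) hm',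
    ← exp_mul_log (x := 1 - (d : ℝ) / m) (k := m - d) fun h => by
      rw [sub_pos, div_lt_one hm']
      exact_mod_cast (by omega : d < m),
    ← Real.exp_add, ← Real.exp_add, Real.exp_eq_one_iff, entropy2,
    Real.binEntropy_eq_negMulLog_add_negMulLog_one_sub, Real.negMulLog, Real.negMulLog,
    Nat.cast_sub hd]
  field_simp
  ring

/-- The exponential factor in the running time of the algorithm. -/
noncomputable def expFactor (m d : ℕ) : ℝ :=
  if 2 * d ≤ m then (2 : ℝ) ^ ((entropy2 ((d : ℝ) / m) - (d : ℝ) / m) * m)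
  else (2 : ℝ) ^ ((1 - (d : ℝ) / m) * m)

/-- With a = δP exactly, the left side over `denom` would be 2^((H₂(δ)-δ)m) for 2d ≤ m; the factor 2
pays for rounding a up. -/
theorem pow_le_denom {m d : ℕ} (hm : 0 < m) (hd : d ≤ m) :
    ((2 : ℝ) ^ (m + 2)) ^ m ≤ 2 * expFactor m d * denom m d m := by
  have hm' : (0 : ℝ) < m := by exact_mod_cast hm
  have hd' : (d : ℝ) ≤ m := by exact_mod_cast hd
  set P : ℝ := 2 ^ (m + 2) with hP
  have hPpos : 0 < P := by positivity
  set δ : ℝ := (d : ℝ) / m with hδ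
  have hδm : δ * m = d := by rw [hδ]; field_simp
  have hδ0 : 0 ≤ δ := by positivity
  have ha2 := threshold_le m d
  have hden : (denom m d m : ℝ) =
      (2 * (threshold m d : ℝ)) ^ d * (P - threshold m d) ^ (m - d) := by
    rw [denom_eq hd]
    push_cast
    rw [Nat.cast_sub (by omega)]
    push_cast
    rfl
  have hPN : ((2 ^ (m + 2) : ℕ) : ℝ) = P := by push_cast; rfl
  have h2P : ((2 ^ (m + 1) : ℕ) : ℝ) = P / 2 := by rw [hP, pow_succ]; push_cast; ring
  have hq1 : P * d ≤ ((2 ^ (m + 2) * d + (m - 1)) / m : ℕ) * m := by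
    have h := Nat.lt_div_mul_add (a := 2 ^ (m + 2) * d + (m - 1)) hm
    have h' : 2 ^ (m + 2) * d ≤ (2 ^ (m + 2) * d + (m - 1)) / m * m := by omega
    rw [← hPN]
    exact_mod_cast h'
  have hq2 : (((2 ^ (m + 2) * d + (m - 1)) / m : ℕ) : ℝ) * m ≤ P * d + m := by
    have h := Nat.div_mul_le_self (2 ^ (m + 2) * d + (m - 1)) m
    have h' : (2 ^ (m + 2) * d + (m - 1)) / m * m ≤ 2 ^ (m + 2) * d + m := by omega
    rw [← hPN]
    exact_mod_cast h'
  unfold expFactor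
  split_ifs with hdm
  · have hdm' : 2 * (d : ℝ) ≤ m := by exact_mod_cast hdm
    have hδ2 : δ ≤ 1 / 2 := by rw [hδ, div_le_iff₀ hm']; linarith
    have ha_lo : P * δ ≤ threshold m d := by
      rw [threshold, Nat.cast_min, h2P]
      refine le_min ?_ (by nlinarith)
      rw [hδ, ← mul_div_assoc, div_le_iff₀ hm']
      exact hq1
    have ha_hi : (threshold m d : ℝ) ≤ P * δ + 1 := by
      have : (threshold m d : ℝ) ≤ ((2 ^ (m + 2) * d + (m - 1)) / m : ℕ) := by
        exact_mod_cast min_le_left _ _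
      refine this.trans ?_
      rw [← mul_le_mul_iff_of_pos_right hm', add_mul, mul_assoc, hδm, one_mul]
      exact hq2
    have hP4 : 4 * (m : ℝ) ≤ P := by
      have : m < 2 ^ m := Nat.lt_two_pow_self
      have : (m : ℝ) ≤ 2 ^ m := by exact_mod_cast this.le
      rw [hP, pow_add]; linarith
    -- Since δ ≤ 1/2, the loss 2(1 - δ) is at least 1 and absorbs the rounding error.
    have hPa : P * (1 - δ) * (1 - 2 / P) ≤ P - threshold m d := by
      have : P * (1 - δ) * (1 - 2 / P) = P - P * δ - 2 * (1 - δ) := by field_simp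
      rw [this]; linarith
    have h2P1 : 2 / P ≤ 1 := by
      rw [div_le_one hPpos]
      have : (1 : ℝ) ≤ m := by exact_mod_cast hm
      linarith
    -- Bernoulli's inequality with P ≥ 4m; the two extra bits in P = 2^(m+2) ensure this.
    have hbern : 1 / 2 ≤ (1 - 2 / P) ^ (m - d) := by
      have h1 := one_add_mul_le_pow (a := -(2 / P)) (by linarith) m
      have h2 : (m : ℝ) * (2 / P) ≤ 1 / 2 := by
        rw [mul_div_assoc', div_le_iff₀ hPpos]; linarith
      calc (1 : ℝ) / 2 ≤ 1 + m * -(2 / P) := by linarith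
        _ ≤ (1 - 2 / P) ^ m := by rw [sub_eq_add_neg]; exact h1
        _ ≤ _ := pow_le_pow_of_le_one (by linarith)
          (by have : 0 ≤ 2 / P := by positivity
              linarith) (Nat.sub_le _ _)
    have hlow : P ^ m * (2 ^ d * (δ ^ d * (1 - δ) ^ (m - d))) * (1 / 2) ≤ denom m d m := by
      rw [hden]
      calc P ^ m * (2 ^ d * (δ ^ d * (1 - δ) ^ (m - d))) * (1 / 2)
          ≤ P ^ m * (2 ^ d * (δ ^ d * (1 - δ) ^ (m - d))) * (1 - 2 / P) ^ (m - d) := by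
            have : 0 ≤ 1 - δ := by linarith
            gcongr
        _ = (2 * (P * δ)) ^ d * (P * (1 - δ) * (1 - 2 / P)) ^ (m - d) := by
            obtain ⟨k, rfl⟩ := Nat.exists_eq_add_of_le hd
            rw [Nat.add_sub_cancel_left, pow_add]
            simp only [mul_pow]
            ring
        _ ≤ _ := by
            have : 0 ≤ 1 - δ := by linarith
            have : 0 ≤ 1 - 2 / P := by linarith
            gcongr
    have hent := two_rpow_entropy2 hm hd
    rw [← hδ] at hent
    have hX : (2 : ℝ) ^ ((entropy2 δ - δ) * m) * 2 ^ d = (2 : ℝ) ^ (entropy2 δ * m) := by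
      rw [← Real.rpow_natCast, ← Real.rpow_add (by norm_num)]
      congr 1
      rw [sub_mul, hδm]; ring
    calc P ^ m = 2 * (2 : ℝ) ^ ((entropy2 δ - δ) * m) *
          (P ^ m * (2 ^ d * (δ ^ d * (1 - δ) ^ (m - d))) * (1 / 2)) := by
          rw [← hX] at hent
          linear_combination (-P ^ m) * hent
      _ ≤ _ := by gcongr
  -- Here a = P/2: every coordinate is fixed, with a fair bit, and the count is exact.
  · have hdm' : (m : ℝ) ≤ 2 * d := by exact_mod_cast (by omega : m ≤ 2 * d)
    have ha : (threshold m d : ℝ) = P / 2 := by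
      rw [threshold, Nat.cast_min, h2P]
      refine min_eq_right ?_
      rw [← mul_le_mul_iff_of_pos_right hm']
      nlinarith
    have e : (1 - δ) * m = ((m - d : ℕ) : ℝ) := by
      rw [sub_mul, hδm, Nat.cast_sub hd]; ring
    rw [e, Real.rpow_natCast, hden, ha]
    have : 2 * (2 : ℝ) ^ (m - d) * ((2 * (P / 2)) ^ d * (P - P / 2) ^ (m - d)) = 2 * P ^ m := by
      obtain ⟨k, rfl⟩ := Nat.exists_eq_add_of_le hd
      rw [Nat.add_sub_cancel_left, pow_add, show P - P / 2 = P / 2 by ring,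
        show 2 * (P / 2) = P by ring, div_pow]
      field_simp
    rw [this]
    have : 0 < P ^ m := by positivity
    linarith

theorem expFactor_pos (m d : ℕ) : 0 < expFactor m d := by
  unfold expFactor
  split_ifs <;> positivity

theorem reps_le {m d : ℕ} (hm : 0 < m) (hd : d ≤ m) :
    (reps m d : ℝ) ≤ 6 * (m + 1) ^ 2 * expFactor m d := by
  have hden : (0 : ℝ) < denom m d m := by exact_mod_cast denom_pos hm
  have h1 := pow_le_denom hm hd
  have h2 : (denom m d m : ℝ) ≤ (2 ^ (m + 2)) ^ m := by exact_mod_cast denom_le m d m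
  -- This absorbs the summand 1 in `reps`, raising the constant from 4 to 6.
  have hX : 1 ≤ 2 * expFactor m d := by
    by_contra h
    have : 2 * expFactor m d * denom m d m < 1 * denom m d m :=
      mul_lt_mul_of_pos_right (not_le.1 h) hden
    linarith
  have h3 : ((2 * ((m + 1) * (m + 1)) * (2 ^ (m + 2)) ^ m / denom m d m : ℕ) : ℝ) ≤
      2 * ((m + 1) * (m + 1)) * (2 * expFactor m d) := by
    refine Nat.cast_div_le.trans ?_
    rw [div_le_iff₀ hden]
    push_cast
    rw [mul_assoc (2 * (((m : ℝ) + 1) * (m + 1)))]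
    gcongr
  have hm1 : (1 : ℝ) ≤ (m + 1) ^ 2 := by
    have : (0 : ℝ) ≤ m := by positivity
    nlinarith
  unfold reps
  rw [Nat.cast_add, Nat.cast_one]
  nlinarith [expFactor_pos m d]

end ClosestPair

namespace ClosestPair

open RAM MeasureTheory

/-! ### The algorithm on the input of the theorem -/

/-- The input words, extended by zeros. -/
def inputBits {n m : ℕ} (x : Fin n → BinWord m) (a k : ℕ) : Bool :=
  if h : a < n ∧ k < m then x ⟨a, h.1⟩ ⟨k, h.2⟩ else false

theorem inputBits_val {n m : ℕ} (x : Fin n → BinWord m) (a : Fin n) (k : Fin m) :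
    inputBits x a k = x a k := by
  simp [inputBits]

theorem dist_inputBits {n m : ℕ} (x : Fin n → BinWord m) (a b : Fin n) :
    dist m (inputBits x a) (inputBits x b) = hammingDist (x a) (x b) := by
  rw [← card_diffSet, diffSet, hammingDist]
  simp only [inputBits_val]

theorem initState_input {n m : ℕ} (x : Fin n → BinWord m) (d : ℕ) (ω : ℕ → Bool) {a k : ℕ}
    (ha : a < n) (hk : k < m) :
    (initState x d ω).arr 0 (a * m + k) = (inputBits x a k).toNat := by
  have h : a * m + k = finProdFinEquiv ((⟨a, ha⟩ : Fin n), (⟨k, hk⟩ : Fin m)) := by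
    simp [mul_comm, add_comm]
  have hlt : a * m + k < n * m := h ▸ Fin.is_lt _
  have h' : (⟨a * m + k, hlt⟩ : Fin (n * m)) =
      finProdFinEquiv ((⟨a, ha⟩ : Fin n), (⟨k, hk⟩ : Fin m)) :=
    Fin.ext h
  simp only [initState, if_true, dif_pos hlt, h', Equiv.symm_apply_apply]
  simp [inputBits, ha, hk]

variable {n m d : ℕ} {x : Fin n → BinWord m} {i j : Fin n}

theorem IsUniqueClosestPair.symm (h : IsUniqueClosestPair x i j d) :
    IsUniqueClosestPair x j i d :=
  ⟨h.1.symm, by rw [hammingDist_comm]; exact h.2.1,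
    fun a b hab hne => h.2.2 a b hab (by rwa [Sym2.eq_swap (a := i)])⟩

theorem IsUniqueClosestPair.dist_le (h : IsUniqueClosestPair x i j d) : d ≤ m := by
  rw [← h.2.1]
  simpa using hammingDist_le_card_fintype (x := x i) (y := x j)

/-- Without point `j` all words are distinct, also when d = 0 and the closest pair coincides; hence
n - 1 ≤ 2^m. -/
theorem IsUniqueClosestPair.card_le (h : IsUniqueClosestPair x i j d) : n ≤ 2 ^ (m + 1) := by
  have hinj : Function.Injective fun a : {a : Fin n // a ≠ j} => x a := by
    rintro ⟨a, ha⟩ ⟨b, hb⟩ hab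
    simp only at hab
    by_contra hne
    have hne' : a ≠ b := fun h => hne (Subtype.ext h)
    have h1 := h.2.2 a b hne' (by
      simp only [ne_eq, Sym2.eq_iff, not_or, not_and]
      exact ⟨fun _ => hb, fun h => absurd h ha⟩)
    rw [hab, hammingDist_self] at h1
    omega
  have hcard := Fintype.card_le_of_injective _ hinj
  simp only [ne_eq, Fintype.card_subtype_compl, Fintype.card_fin, Fintype.card_unique,
    Fintype.card_pi, Fintype.card_bool, Finset.prod_const, Finset.card_univ] at hcard
  have := Nat.one_le_two_pow (n := m)
  rw [pow_succ]
  omega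

theorem IsUniqueClosestPair.uniquePair (h : IsUniqueClosestPair x i j d) (hij : i < j) :
    UniquePair n m d (inputBits x) i j := by
  refine ⟨hij, j.2, by rw [dist_inputBits, h.2.1], fun a ha b hb hab hd => ?_⟩
  have hd' : hammingDist (x ⟨a, ha⟩) (x ⟨b, hb⟩) ≤ d := by rwa [← dist_inputBits]
  have h1 : s((⟨a, ha⟩ : Fin n), ⟨b, hb⟩) = s(i, j) := by
    by_contra hne
    exact absurd (h.2.2 ⟨a, ha⟩ ⟨b, hb⟩ (by simpa using hab) hne) (not_lt.2 hd')
  simpa using congrArg (Sym2.map Fin.val) h1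

/-- The polynomial factor in the running time of the algorithm. -/
noncomputable def timePoly : Polynomial ℕ := 6552000 * (Polynomial.X + 1) ^ 6

theorem time_le (hm : 0 < m) (hd : d ≤ m) (hn : 2 ≤ n) :
    ((steps n m d * unitCost (width m) : ℕ) : ℝ) ≤
      n * expFactor m d * ((timePoly.eval m : ℕ) : ℝ) := by
  have h1 : steps n m d ≤ reps m d * n * (42 * (m + 1) ^ 2) := by
    have hR : 1 ≤ reps m d := Nat.le_add_left _ _
    have hRn : 1 ≤ reps m d * n := Nat.mul_pos hR (by omega)
    have e : steps n m d = (8 * m + 21) + reps m d * (4 * m ^ 2 + 14 * m + 6)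
        + reps m d * n * (8 * m + 15) := by
      unfold steps; ring
    rw [e]
    calc _ ≤ reps m d * n * (8 * m + 21) + reps m d * n * (4 * m ^ 2 + 14 * m + 6)
          + reps m d * n * (8 * m + 15) := by
          gcongr
          · exact Nat.le_mul_of_pos_left _ hRn
          · exact Nat.le_mul_of_pos_right _ (by omega)
      _ = reps m d * n * (4 * m ^ 2 + 30 * m + 42) := by ring
      _ ≤ _ := by gcongr; nlinarith
  have h2 : unitCost (width m) ≤ 26000 * (m + 1) ^ 2 := by
    unfold unitCost width; nlinarith
  have h3 := reps_le hm hd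
  have h4 : ((steps n m d * unitCost (width m) : ℕ) : ℝ) ≤
      reps m d * n * (42 * (m + 1) ^ 2) * (26000 * (m + 1) ^ 2) := by
    exact_mod_cast Nat.mul_le_mul h1 h2
  refine h4.trans ?_
  have h5 : ((timePoly.eval m : ℕ) : ℝ) = 6552000 * ((m : ℝ) + 1) ^ 6 := by
    simp [timePoly]
  rw [h5]
  -- The constant of `timePoly` is 6 · 42 · 26000.
  calc _ ≤ 6 * ((m : ℝ) + 1) ^ 2 * expFactor m d * n * (42 * (m + 1) ^ 2) *
        (26000 * (m + 1) ^ 2) := by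
        gcongr
    _ = _ := by ring

theorem FindsPair.mono {p : Prog} {dec : Option (BinWord m → BinWord m)} {T T' : ℝ}
    (h : FindsPair p dec x d i j T) (hT : T ≤ T') : FindsPair p dec x d i j T' := by
  refine ⟨fun ω => ?_, h.2⟩
  obtain ⟨t, f, h1, h2⟩ := h.1 ω
  exact ⟨t, f, h1, h2.trans hT⟩

theorem findsPair_of_lt (dec : Option (BinWord m → BinWord m)) (hm : 0 < m)
    (h : IsUniqueClosestPair x i j d) (hij : i < j) :
    FindsPair mainProg dec x d i j (n * expFactor m d * ((timePoly.eval m : ℕ) : ℝ)) := by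
  have hd := IsUniqueClosestPair.dist_le h
  have hn := IsUniqueClosestPair.card_le h
  have hn2 : 2 ≤ n := by have := i.2; have := j.2; have : (i : ℕ) < j := hij; omega
  have hX := IsUniqueClosestPair.uniquePair h hij
  have run : ∀ ω : ℕ → Bool, ∃ (t : ℕ) (f : State), Exec dec mainProg (initState x d ω) t f ∧
      (t : ℝ) ≤ n * expFactor m d * ((timePoly.eval m : ℕ) : ℝ) ∧
      ((∃ ρ < reps m d, Good m d (partialWord m d fun l => ω (ρ * (m * (m + 2)) + l))
        (inputBits x i) (inputBits x j)) → s(f.reg 0, f.reg 1) = s((i : ℕ), (j : ℕ))) := by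
    intro ω
    have hbound : Bounded (width m) (initState x d ω) := by
      have hmw : m < 2 ^ width m := le_lt_width (by omega)
      have hdw : d < 2 ^ width m := le_lt_width (by omega)
      have hnw : n < 2 ^ width m := hn.trans_lt (two_pow_lt_width (by nlinarith))
      have h0 : 0 < 2 ^ width m := by positivity
      constructor
      · intro r
        simp only [initState]
        split_ifs <;> assumption
      · intro a k
        simp only [initState]
        split_ifs
        · exact le_lt_width ((Bool.toNat_le _).trans (by omega))
        · exact h0
        · exact h0
    obtain ⟨t, f, h1, h2, -, h3⟩ := wp_mainProg (dec := dec) (s := initState x d ω) hm hd hn hX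
      rfl rfl rfl (fun a ha k hk => initState_input x d ω ha hk) (fun k => rfl) (ω := ω) rfl hbound
    exact ⟨t, f, h1, (Nat.cast_le.2 h2).trans (time_le hm hd hn2), h3⟩
  refine ⟨fun ω => ?_, ?_⟩
  · obtain ⟨t, f, h1, h2, -⟩ := run ω
    exact ⟨t, f, h1, h2⟩
  · have hfail := failure_le hm hd (by omega : 0 < n) hn
      (y := inputBits x i) (y' := inputBits x j) hX.dist_eq
    set S := {ω : ℕ → Bool | ∃ (t : ℕ) (f : State), Exec dec mainProg (initState x d ω) t f ∧
      s(f.reg 0, f.reg 1) = s((i : ℕ), (j : ℕ))}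
    set F := {ω : ℕ → Bool | ¬ ∃ ρ < reps m d,
      Good m d (partialWord m d fun l => ω (ρ * (m * (m + 2)) + l)) (inputBits x i)
        (inputBits x j)}
    have hcov : S ∪ F = Set.univ := by
      refine Set.eq_univ_of_forall fun ω => ?_
      by_cases hω : ω ∈ F
      · exact .inr hω
      · obtain ⟨t, f, h1, -, h3⟩ := run ω
        exact .inl ⟨t, f, h1, h3 (not_not.1 hω)⟩
    -- Subadditivity does not require the success event to be measurable.
    have := measureReal_union_le (μ := fairBits) S F
    rw [hcov, probReal_univ] at this
    linarith

theorem findsPair (dec : Option (BinWord m → BinWord m)) (hm : 0 < m)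
    (h : IsUniqueClosestPair x i j d) :
    FindsPair mainProg dec x d i j (n * expFactor m d * ((timePoly.eval m : ℕ) : ℝ)) := by
  rcases lt_or_gt_of_ne h.1 with hij | hij
  · exact findsPair_of_lt dec hm h hij
  · have := findsPair_of_lt dec hm (IsUniqueClosestPair.symm h) hij
    unfold FindsPair at this ⊢
    rwa [Sym2.eq_swap (a := (i : ℕ))]

/-! ### Comparison with the two claimed running times. -/

theorem one_le_logb_sq (hn : 2 ≤ n) : 1 ≤ Real.logb 2 n ^ 2 := by
  have : 1 ≤ Real.logb 2 n := by
    rw [Real.le_logb_iff_rpow_le (by norm_num) (by positivity), Real.rpow_one]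
    exact_mod_cast hn
  nlinarith

theorem expFactor_le_zyablov (hm : 0 < m) (hd : d ≤ m) :
    expFactor m d ≤ (2 : ℝ) ^ ((1 - zyablovRate ((d : ℝ) / m) - (d : ℝ) / m) * m) := by
  have hm' : (0 : ℝ) < m := by exact_mod_cast hm
  have h0 : 0 ≤ (d : ℝ) / m := by positivity
  have h1 : (d : ℝ) / m ≤ 1 := by rw [div_le_one hm']; exact_mod_cast hd
  unfold expFactor
  split_ifs with h
  · have := zyablovRate_le h0 h1
    gcongr
    · norm_num
    · linarith
  · have h2 : 1 / 2 ≤ (d : ℝ) / m := by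
      have : (m : ℝ) ≤ 2 * d := by exact_mod_cast (by omega : m ≤ 2 * d)
      rw [le_div_iff₀ hm']; linarith
    have := zyablovRate_nonpos h2 h1
    gcongr
    · norm_num
    · linarith

/-- The Plotkin bound. -/
theorem card_le_of_hasMinDist {C : Finset (BinWord m)} {e : ℕ} (hC : HasMinDist C e)
    (he : m < 2 * e) : C.card ≤ 2 * e := by
  set K := C.card with hK
  -- Distances over ordered pairs are counted twice: below by the minimum distance, above coordinate
  -- by coordinate.
  have hlow : K * (K - 1) * e ≤ ∑ c ∈ C, ∑ c' ∈ C, hammingDist c c' := by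
    rw [mul_assoc, hK, ← smul_eq_mul C.card]
    refine Finset.card_nsmul_le_sum _ _ _ fun c hc => ?_
    rw [← Finset.card_erase_of_mem hc, ← smul_eq_mul]
    refine (Finset.card_nsmul_le_sum (C.erase c) (hammingDist c) e fun c' hc' => ?_).trans
      (Finset.sum_le_sum_of_subset (Finset.erase_subset _ _))
    exact hC c hc c' (Finset.mem_of_mem_erase hc') (Finset.ne_of_mem_erase hc').symm
  have hup : 2 * ∑ c ∈ C, ∑ c' ∈ C, hammingDist c c' ≤ m * K ^ 2 := by
    have hswap : ∑ c ∈ C, ∑ c' ∈ C, hammingDist c c' =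
        ∑ k : Fin m, ∑ c ∈ C, ∑ c' ∈ C, if c k ≠ c' k then 1 else 0 := by
      simp only [hammingDist, Finset.card_filter]
      simp_rw [Finset.sum_comm (s := C) (t := Finset.univ)]
    -- With A ones and B zeros in the coordinate there are 2AB ≤ K²/2 ordered pairs that differ.
    have hcoord : ∀ k : Fin m,
        2 * ∑ c ∈ C, ∑ c' ∈ C, (if c k ≠ c' k then 1 else 0) ≤ K ^ 2 := by
      intro k
      set A := (C.filter fun c => c k = true).card
      set B := (C.filter fun c => ¬ c k = true).card
      have hAB : A + B = K := Finset.card_filter_add_card_filter_not _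
      have hin : ∀ c : BinWord m, ∑ c' ∈ C, (if c k ≠ c' k then 1 else 0) =
          if c k = true then B else A := by
        intro c
        rw [← Finset.card_filter]
        cases c k <;> simp [A, B]
      simp only [hin]
      rw [Finset.sum_ite, Finset.sum_const, Finset.sum_const, smul_eq_mul, smul_eq_mul, ← hAB]
      change 2 * (A * B + B * A) ≤ (A + B) ^ 2
      zify
      nlinarith [sq_nonneg ((A : ℤ) - B)]
    rw [hswap, Finset.mul_sum]
    refine (Finset.sum_le_card_nsmul _ _ _ fun k _ => hcoord k).trans ?_
    simp
  by_contra hcon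
  obtain ⟨q, hq⟩ : ∃ q, K = q + 1 := ⟨K - 1, by omega⟩
  rw [hq, Nat.add_sub_cancel] at hlow
  rw [hq] at hup hcon
  have h1 : 2 * (q * e) ≤ m * (q + 1) := by
    have h : (q + 1) * (2 * (q * e)) ≤ (q + 1) * (m * (q + 1)) := by nlinarith
    exact Nat.le_of_mul_le_mul_left h (Nat.succ_pos q)
  nlinarith

/-- For 2d > m the Plotkin bound leaves only polynomially many codewords, so a code meeting the
Gilbert–Varshamov bound can exist only if H₂(δ) is within O(log(m)/m) of 1. -/
theorem expFactor_le_entropy (hm : 0 < m) (hd : d ≤ m) {C : Finset (BinWord m)}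
    (hC : HasMinDist C (d + 1)) (hGV : MeetsGV C (d + 1)) :
    expFactor m d ≤
      2 * (m + 1) * (2 : ℝ) ^ ((entropy2 ((d : ℝ) / m) - (d : ℝ) / m) * m) := by
  have hm' : (0 : ℝ) < m := by exact_mod_cast hm
  have hlog := Real.log_pos (by norm_num : (1 : ℝ) < 2)
  set δ := (d : ℝ) / m with hδ
  have h0 : 0 ≤ δ := by positivity
  have h1 : δ ≤ 1 := by rw [hδ, div_le_one hm']; exact_mod_cast hd
  unfold expFactor
  rw [← hδ]
  split_ifs with h
  · have : (0 : ℝ) < (2 : ℝ) ^ ((entropy2 δ - δ) * m) := by positivity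
    nlinarith
  · have h2 : (2 : ℝ)⁻¹ ≤ δ := by
      have : (m : ℝ) ≤ 2 * d := by exact_mod_cast (by omega : m ≤ 2 * d)
      rw [hδ, le_div_iff₀ hm']; linarith
    have hK : (C.card : ℝ) ≤ 2 * (m + 1) := by
      have := card_le_of_hasMinDist hC (by omega)
      exact_mod_cast this.trans (by omega)
    have hent : entropy2 (((d + 1 : ℕ) : ℝ) / m) ≤ entropy2 δ := by
      have hle : δ ≤ ((d + 1 : ℕ) : ℝ) / m := by rw [hδ]; gcongr; omega
      rcases le_or_gt (((d + 1 : ℕ) : ℝ) / m) 1 with h3 | h3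
      · exact div_le_div_of_nonneg_right (Real.binEntropy_strictAntiOn.antitoneOn ⟨h2, h1⟩
          ⟨h2.trans hle, h3⟩ hle) hlog.le
      -- This is d = m: the argument exceeds 1, where the formula for the entropy takes negative
      -- values.
      · exact (div_nonpos_of_nonpos_of_nonneg (Real.binEntropy_neg_of_one_lt h3).le
          hlog.le).trans (entropy2_nonneg h0 h1)
    have hpow : (2 : ℝ) ^ ((1 - entropy2 δ) * m) ≤ 2 * (m + 1) := by
      refine le_trans ?_ (hGV.trans hK)
      gcongr
      norm_num
    calc (2 : ℝ) ^ ((1 - δ) * m) =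
        (2 : ℝ) ^ ((1 - entropy2 δ) * m) * (2 : ℝ) ^ ((entropy2 δ - δ) * m) := by
          rw [← Real.rpow_add (by norm_num)]
          congr 1
          ring
      _ ≤ _ := by gcongr

end ClosestPair

/-- Part one: a randomized algorithm for the closest pair problem with time
`O(n log² n · 2 ^ ((1 - κ_Z(δ) - δ) m) · poly(m))`, where `δ = d / m`. Part two: the same with time
`O(n log² n · 2 ^ ((H₂(δ) - δ) m) · poly(m))`, given a black-box unique decoder for an
`(m, K, d + 1)`-code that meets the Gilbert-Varshamov bound. In both parts one program and one
polynomial (which absorbs the constant) serve all inputs. -/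
theorem theorem3p1 :
    (∃ (p : RAM.Prog) (P : Polynomial ℕ), ∀ (n m d : ℕ) (x : Fin n → BinWord m) (i j : Fin n),
      0 < m → IsUniqueClosestPair x i j d →
        RAM.FindsPair p none x d i j
          ((n : ℝ) * Real.logb 2 n ^ 2 *
            (2 : ℝ) ^ ((1 - zyablovRate ((d : ℝ) / m) - (d : ℝ) / m) * m) *
            ((P.eval m : ℕ) : ℝ))) ∧
    (∃ (p : RAM.Prog) (P : Polynomial ℕ), ∀ (n m d : ℕ) (x : Fin n → BinWord m) (i j : Fin n)
      (C : Finset (BinWord m)) (D : BinWord m → BinWord m),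
      0 < m → IsUniqueClosestPair x i j d →
      HasMinDist C (d + 1) → MeetsGV C (d + 1) → IsUniqueDecoder C (d + 1) D →
        RAM.FindsPair p (some D) x d i j
          ((n : ℝ) * Real.logb 2 n ^ 2 *
            (2 : ℝ) ^ ((entropy2 ((d : ℝ) / m) - (d : ℝ) / m) * m) *
            ((P.eval m : ℕ) : ℝ))) := by
  have two_le : ∀ {n : ℕ} {i j : Fin n}, i ≠ j → 2 ≤ n := fun {n i j} h => by
    have := i.2; have := j.2; have := Fin.val_ne_of_ne h; omega
  refine ⟨⟨ClosestPair.mainProg, ClosestPair.timePoly, ?_⟩,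
    -- The extra factor 2(m+1) is the bound on the number of codewords.
    ⟨ClosestPair.mainProg, 2 * (Polynomial.X + 1) * ClosestPair.timePoly, ?_⟩⟩
  · intro n m d x i j hm h
    have hlog := ClosestPair.one_le_logb_sq (two_le h.1)
    have hX := ClosestPair.expFactor_le_zyablov hm (ClosestPair.IsUniqueClosestPair.dist_le h)
    refine ClosestPair.FindsPair.mono (ClosestPair.findsPair none hm h) ?_
    have hpos := ClosestPair.expFactor_pos m d
    gcongr
    -- The factor log² n is pure slack: amplification costs powers of m + 1 instead.
    exact le_mul_of_one_le_right (by positivity) hlog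
  · intro n m d x i j C D hm h hC hGV _
    have hlog := ClosestPair.one_le_logb_sq (two_le h.1)
    have hX := ClosestPair.expFactor_le_entropy hm (ClosestPair.IsUniqueClosestPair.dist_le h)
      hC hGV
    refine ClosestPair.FindsPair.mono (ClosestPair.findsPair (some D) hm h) ?_
    set Z := (2 : ℝ) ^ ((entropy2 ((d : ℝ) / m) - (d : ℝ) / m) * m)
    have hP : (((2 * (Polynomial.X + 1) * ClosestPair.timePoly).eval m : ℕ) : ℝ) =
        2 * (m + 1) * ((ClosestPair.timePoly.eval m : ℕ) : ℝ) := by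
      simp
    have hZ : 0 < Z := by positivity
    rw [hP]
    calc (n : ℝ) * ClosestPair.expFactor m d * ((ClosestPair.timePoly.eval m : ℕ) : ℝ)
        ≤ (n : ℝ) * 1 * (2 * (m + 1) * Z) * ((ClosestPair.timePoly.eval m : ℕ) : ℝ) := by
          rw [mul_one]; gcongr
      _ ≤ (n : ℝ) * Real.logb 2 n ^ 2 * (2 * (m + 1) * Z) *
          ((ClosestPair.timePoly.eval m : ℕ) : ℝ) := by gcongr
      _ = _ := by ring
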